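/- Let $w(t)=(w_1(t),\dots,w_d(t))$, $0\le t\le 1$, be a $d$-dimensional Brownian motion on a probability space $(\Omega,\mathcal F,\mathbb P)$, and let $p^d_\varepsilon(z)=(2\pi\varepsilon)^{-d/2}\exp\big(-\|z\|^2/(2\varepsilon)\big)$ for $z\in\mathbb R^d$, $\varepsilon>0$, with $\|\cdot\|$ the Euclidean norm. For $\gamma\in\mathbb R$ let $\mathbb D^{2,\gamma}$ be the completion of the space of finite sums $\sum_{k=0}^n I_k(f_k)$ of multiple Itô integrals (with respect to $w$) of symmetric square integrable kernels, with respect to the norm $$\Big\|\sum_{k=0}^n I_k(f_k)\Big\|_{2,\gamma}^2=\sum_{k=0}^n (k+1)^\gamma\,\mathbb E\big[I_k(f_k)^2\big].$$ For $\gamma\le 0$ the space $L^2(\Omega,\sigma(w),\mathbb P)$ is contained in $\mathbb D^{2,\gamma}$ via the Itô–Wiener expansion, and $\mathbb D^{2,\gamma'}\subseteq\mathbb D^{2,\gamma}$ for $\gamma\le\gamma'$; for $\gamma<0$ the elements of $\mathbb D^{2,\gamma}$ are called generalised Wiener functions. **Proposition.** Let $u\in\mathbb R^d\setminus\{0\}$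 and $0<s<t<1$. Then the limit $$\delta_u(w(t)-w(s))=\lim_{\varepsilon\to 0^+}p^d_\varepsilon\big(w(t)-w(s)-u\big)$$ exists in $\mathbb D^{2,\gamma}$ for every $\gamma<-d/2$, and it is the same generalised Wiener function for all these $\gamma$. Moreover, for every $\gamma<-d/2$, $$\big\|\delta_u(w(t)-w(s))\big\|_{2,\gamma}\le C\,p^d_{t-s}(c\,u),$$ where $C>0$ and $c>0$ are constants that depend only on $\gamma$. -/

import Mathlib

open MeasureTheory ProbabilityTheory Filter Topology

noncomputable section

namespace WienerChaos

/-- The heat kernel `p^d_ε(z) = (2πε)^{-d/2} exp(-‖z‖² / (2ε))` on `ℝ^d` (used for `ε > 0`). -/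
def heatKernel {d : ℕ} (ε : ℝ) (z : EuclideanSpace ℝ (Fin d)) : ℝ :=
  1 / (2 * Real.pi * ε) ^ ((d : ℝ) / 2) * Real.exp (-‖z‖ ^ 2 / (2 * ε))

/-- `w` is a standard `d`-dimensional Brownian motion on the time interval `[0,1]`. -/
structure IsBrownianMotion {d : ℕ} {Ω : Type*} [MeasurableSpace Ω]
    (w : unitInterval → Ω → EuclideanSpace ℝ (Fin d)) (P : Measure Ω) : Prop where
  measurable : ∀ t, Measurable (w t)
  zero : ∀ᵐ ω ∂P, w 0 ω = 0
  continuous_paths : ∀ᵐ ω ∂P, Continuous fun t => w t ω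
  indep_increments : HasIndepIncrements w P
  law_increments : ∀ s t : unitInterval, s ≤ t →
    HasLaw (fun ω (j : Fin d) => w t ω j - w s ω j)
      (Measure.pi fun _ : Fin d => gaussianReal 0 (Real.toNNReal ((t : ℝ) - (s : ℝ)))) P

/-- The measure on `([0,1] × {1, …, d})^k` for which kernels are square integrable: Lebesgue
measure in the times, counting measure in the component indices. -/
def kernelMeasure (d k : ℕ) : Measure (Fin k → unitInterval × Fin d) :=
  Measure.pi fun _ => (volume : Measure unitInterval).prod Measure.count

/-- The square integrable kernels of order `k`. The variable `(t_i, j_i)`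
carries the time `t_i` and the component `j_i` of the integrator `dw_{j_i}(t_i)`. -/
abbrev Kernel2 (d k : ℕ) : Type := Lp ℝ 2 (kernelMeasure d k)

/-- A kernel is symmetric if it has a representative that is invariant under all permutations
of its `k` variables. -/
def IsSymmKernel {d k : ℕ} (f : Kernel2 d k) : Prop :=
  ∃ g : (Fin k → unitInterval × Fin d) → ℝ,
    (∀ (π : Equiv.Perm (Fin k)) (x : Fin k → unitInterval × Fin d), g (x ∘ π) = g x) ∧
      f =ᵐ[kernelMeasure d k] g

section Construction

variable {d : ℕ} {Ω : Type*} [MeasurableSpace Ω]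

/-- The elementary `k`-fold integrals: the kernel is the indicator function of a product
`A_1 × ⋯ × A_k` of pairwise disjoint sets `A_i = (a_i, b_i] × {j_i}`, and its integral is
`∏ i, (w_{j_i}(b_i) - w_{j_i}(a_i))`. -/
def elementaryIntegrals (w : unitInterval → Ω → EuclideanSpace ℝ (Fin d)) (P : Measure Ω) (k : ℕ) :
    Set (Kernel2 d k × Lp ℝ 2 P) :=
  {p | ∃ (a b : Fin k → unitInterval) (j : Fin k → Fin d), (∀ i, a i ≤ b i) ∧
    (Pairwise fun i i' => Disjoint (Set.Ioc (a i) (b i) ×ˢ ({j i} : Set (Fin d)))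
      (Set.Ioc (a i') (b i') ×ˢ ({j i'} : Set (Fin d)))) ∧
    p.1 =ᵐ[kernelMeasure d k]
      (Set.univ.pi fun i => Set.Ioc (a i) (b i) ×ˢ ({j i} : Set (Fin d))).indicator 1 ∧
    p.2 =ᵐ[P] fun ω => ∏ i, (w (b i) ω (j i) - w (a i) ω (j i))}

/-- The graph of the `k`-fold multiple Itô integral `f ↦ I_k(f)`, as a subspace of
`L²(([0,1] × {1, …, d})^k) × L²(Ω)`: the elementary integrals, extended linearly and then by
`L²`-continuity. -/
def multipleIntegralGraph (w : unitInterval → Ω → EuclideanSpace ℝ (Fin d)) (P : Measure Ω) (k : ℕ) :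
    Submodule ℝ (Kernel2 d k × Lp ℝ 2 P) :=
  (Submodule.span ℝ (elementaryIntegrals w P k)).topologicalClosure

/-- `X = I_k(f)`. -/
def IsMultipleIntegral (w : unitInterval → Ω → EuclideanSpace ℝ (Fin d)) (P : Measure Ω) (k : ℕ)
    (f : Kernel2 d k) (X : Lp ℝ 2 P) : Prop :=
  (f, X) ∈ multipleIntegralGraph w P k

/-- The `k`-th Wiener chaos: the multiple Itô integrals `I_k(f)` of symmetric square integrable
kernels `f`. -/
def chaos (w : unitInterval → Ω → EuclideanSpace ℝ (Fin d)) (P : Measure Ω) (k : ℕ) :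
    Submodule ℝ (Lp ℝ 2 P) where
  carrier := {X | ∃ f : Kernel2 d k, IsSymmKernel f ∧ IsMultipleIntegral w P k f X}
  zero_mem' := by
    refine ⟨0, ⟨0, fun _ _ => rfl, Lp.coeFn_zero _ _ _⟩, ?_⟩
    exact (multipleIntegralGraph w P k).zero_mem
  add_mem' := by
    rintro X Y ⟨f, ⟨g, hg, hfg⟩, hX⟩ ⟨f', ⟨g', hg', hfg'⟩, hY⟩
    refine ⟨f + f', ⟨g + g', fun π x => ?_, ?_⟩, ?_⟩
    · simp [hg π x, hg' π x]
    · exact (Lp.coeFn_add f f').trans (hfg.add hfg')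
    · exact (multipleIntegralGraph w P k).add_mem hX hY
  smul_mem' := by
    rintro c X ⟨f, ⟨g, hg, hfg⟩, hX⟩
    refine ⟨c • f, ⟨c • g, fun π x => ?_, ?_⟩, ?_⟩
    · simp [hg π x]
    · exact (Lp.coeFn_smul c f).trans (hfg.const_smul c)
    · exact (multipleIntegralGraph w P k).smul_mem c hX

/-- The finite sums `∑_{k ≤ n} I_k(f_k)`, recorded through their chaos components, to be given the
norm `‖·‖_{2,γ}`. -/
def FiniteChaos (w : unitInterval → Ω → EuclideanSpace ℝ (Fin d)) (P : Measure Ω) (_γ : ℝ) : Type _ :=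
  Π₀ k : ℕ, chaos w P k

namespace FiniteChaos

variable (w : unitInterval → Ω → EuclideanSpace ℝ (Fin d)) (P : Measure Ω) (γ : ℝ)

instance : AddCommGroup (FiniteChaos w P γ) :=
  inferInstanceAs (AddCommGroup (Π₀ k : ℕ, chaos w P k))

instance : Module ℝ (FiniteChaos w P γ) :=
  inferInstanceAs (Module ℝ (Π₀ k : ℕ, chaos w P k))

variable {w P γ}

/-- The `k`-th chaos component of a finite sum. -/
def component (F : FiniteChaos w P γ) (k : ℕ) : chaos w P k :=
  DFinsupp.toFun F k

/-- An element of the `k`-th chaos as a finite sum with one term. -/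
def single (k : ℕ) (X : chaos w P k) : FiniteChaos w P γ :=
  DFinsupp.single k X

open Classical in
/-- The finite set of indices of the nonzero chaos components. -/
def supp (F : FiniteChaos w P γ) : Finset ℕ :=
  DFinsupp.support (β := fun k : ℕ => chaos w P k) F

theorem mem_supp (F : FiniteChaos w P γ) (k : ℕ) : k ∈ F.supp ↔ F.component k ≠ 0 := by
  classical
  exact DFinsupp.mem_support_iff

theorem component_add (F G : FiniteChaos w P γ) (k : ℕ) :
    (F + G).component k = F.component k + G.component k := rfl

theorem component_smul (c : ℝ) (F : FiniteChaos w P γ) (k : ℕ) :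
    (c • F).component k = c • F.component k := rfl

theorem ext_component {F G : FiniteChaos w P γ} (h : ∀ k, F.component k = G.component k) :
    F = G :=
  DFinsupp.ext h

/-- The inner product `∑_k (k+1)^γ E[I_k(f_k) I_k(g_k)]`. -/
def innerProd (F G : FiniteChaos w P γ) : ℝ :=
  ∑ k ∈ F.supp, ((k : ℝ) + 1) ^ γ * inner ℝ (F.component k) (G.component k)

theorem innerProd_eq_sum (F G : FiniteChaos w P γ) {S : Finset ℕ} (hS : F.supp ⊆ S) :
    F.innerProd G =
      ∑ k ∈ S, ((k : ℝ) + 1) ^ γ * inner ℝ (F.component k) (G.component k) := by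
  refine Finset.sum_subset hS fun k _ hk => ?_
  have h : F.component k = 0 := by
    by_contra h
    exact hk ((mem_supp F k).2 h)
  simp [h]

/-- The inner product space structure of `‖·‖_{2,γ}`. -/
@[reducible]
def core (w : unitInterval → Ω → EuclideanSpace ℝ (Fin d)) (P : Measure Ω) (γ : ℝ) :
    InnerProductSpace.Core ℝ (FiniteChaos w P γ) where
  inner F G := F.innerProd G
  conj_inner_symm F G := by
    simp only [conj_trivial]
    rw [innerProd_eq_sum G F (Finset.subset_union_right (s₁ := F.supp)),
      innerProd_eq_sum F G (Finset.subset_union_left (s₂ := G.supp))]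
    exact Finset.sum_congr rfl fun k _ => by rw [real_inner_comm]
  re_inner_nonneg F := by
    refine Finset.sum_nonneg fun k _ => mul_nonneg (by positivity) real_inner_self_nonneg
  add_left F G H := by
    rw [innerProd_eq_sum (F + G) H (S := (F + G).supp ∪ (F.supp ∪ G.supp)) (by simp),
      innerProd_eq_sum F H (S := (F + G).supp ∪ (F.supp ∪ G.supp)) (by grind),
      innerProd_eq_sum G H (S := (F + G).supp ∪ (F.supp ∪ G.supp)) (by grind),
      ← Finset.sum_add_distrib]
    exact Finset.sum_congr rfl fun k _ => by rw [component_add, inner_add_left, mul_add]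
  smul_left F G c := by
    rw [innerProd_eq_sum (c • F) G (S := (c • F).supp ∪ F.supp) (by simp),
      innerProd_eq_sum F G (S := (c • F).supp ∪ F.supp) (by simp), Finset.mul_sum]
    refine Finset.sum_congr rfl fun k _ => ?_
    have h : inner ℝ (c • F.component k) (G.component k) =
        c * inner ℝ (F.component k) (G.component k) :=
      real_inner_smul_left (F.component k) (G.component k) c
    rw [component_smul, h, conj_trivial]
    ring
  definite F h := by
    refine ext_component fun k => ?_
    by_contra hk
    have hk' := (mem_supp F k).2 hk
    have h0 := (Finset.sum_eq_zero_iff_of_nonneg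
      (fun k _ => mul_nonneg (by positivity) real_inner_self_nonneg)).1 h k hk'
    have hpos : (0 : ℝ) < ((k : ℝ) + 1) ^ γ := by positivity
    exact hk (inner_self_eq_zero.1 ((mul_eq_zero.1 h0).resolve_left hpos.ne'))

instance : NormedAddCommGroup (FiniteChaos w P γ) :=
  (core w P γ).toNormedAddCommGroup

instance : InnerProductSpace ℝ (FiniteChaos w P γ) :=
  InnerProductSpace.ofCore (core w P γ).toCore

/-- The norm is `‖∑ I_k(f_k)‖²_{2,γ} = ∑ (k+1)^γ E[I_k(f_k)²]`. -/
theorem norm_sq_eq (F : FiniteChaos w P γ) :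
    ‖F‖ ^ 2 = ∑ k ∈ F.supp, ((k : ℝ) + 1) ^ γ * ∫ ω, ((F.component k : Lp ℝ 2 P) ω) ^ 2 ∂P := by
  rw [← real_inner_self_eq_norm_sq F]
  refine Finset.sum_congr rfl fun k _ => ?_
  rw [Submodule.coe_inner, L2.inner_def]
  congr 1
  refine integral_congr_ae (Eventually.of_forall fun ω => ?_)
  simp [sq]

/-- The identity map on finite sums, as a contraction from the `γ'`-norm to the `γ`-norm. -/
def weaken (w : unitInterval → Ω → EuclideanSpace ℝ (Fin d)) (P : Measure Ω) {γ γ' : ℝ} (h : γ ≤ γ') :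
    FiniteChaos w P γ' →L[ℝ] FiniteChaos w P γ :=
  LinearMap.mkContinuous
    { toFun := fun F => (F : Π₀ k : ℕ, chaos w P k)
      map_add' := fun _ _ => rfl
      map_smul' := fun _ _ => rfl } 1 (by
    intro F
    rw [one_mul]
    refine le_of_sq_le_sq ?_ (norm_nonneg F)
    rw [norm_sq_eq, norm_sq_eq]
    refine Finset.sum_le_sum fun k _ => ?_
    refine mul_le_mul_of_nonneg_right ?_ (integral_nonneg fun ω => sq_nonneg _)
    exact Real.rpow_le_rpow_of_exponent_le (by linarith [k.cast_nonneg (α := ℝ)]) h)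

end FiniteChaos

/-- The Sobolev space `𝔻^{2,γ}`: the completion of the finite sums of multiple integrals
with respect to `‖·‖_{2,γ}`. -/
abbrev SobolevD (w : unitInterval → Ω → EuclideanSpace ℝ (Fin d)) (P : Measure Ω) (γ : ℝ) : Type _ :=
  UniformSpace.Completion (FiniteChaos w P γ)

/-- The inclusion `𝔻^{2,γ'} ⊆ 𝔻^{2,γ}` for `γ ≤ γ'`: the continuous extension of the identity
map on finite sums. -/
def sobolevInclusion (w : unitInterval → Ω → EuclideanSpace ℝ (Fin d)) (P : Measure Ω) {γ γ' : ℝ}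
    (h : γ ≤ γ') : SobolevD w P γ' → SobolevD w P γ :=
  UniformSpace.Completion.map (FiniteChaos.weaken w P h)

/-- `η ∈ 𝔻^{2,γ}` is the square integrable random variable `X`: they have the same Itô–Wiener
expansion, that is, `X = ∑_k X_k` in `L²(Ω)` and `η = ∑_k X_k` in `𝔻^{2,γ}` for some `X_k` in the
`k`-th chaos. (As the chaoses are mutually orthogonal, the `X_k` are determined by `X`; for
`γ ≤ 0` this is the inclusion `L²(Ω, σ(w), P) ⊆ 𝔻^{2,γ}`.) -/
def IsRandomVariable {w : unitInterval → Ω → EuclideanSpace ℝ (Fin d)} {P : Measure Ω} {γ : ℝ}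
    (η : SobolevD w P γ) (X : Ω → ℝ) : Prop :=
  ∃ Y : Lp ℝ 2 P, Y =ᵐ[P] X ∧ ∃ Z : (k : ℕ) → chaos w P k,
    HasSum (fun k => (Z k : Lp ℝ 2 P)) Y ∧
      HasSum (fun k => ((FiniteChaos.single k (Z k) : FiniteChaos w P γ) : SobolevD w P γ)) η

end Construction

end WienerChaos

end

/-!
Put `τ = t - s` and `X = w t - w s`, a centred Gaussian vector with independent coordinates of
variance `τ`. Everything is read off from the Hermite expansion of the heat kernel of variance `ε`
at `X - u`. With `σ = τ + ε`, repeated Gaussian integration by parts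
(`integral_divHermite_succ_mul`, `integral_divHermite_mul_gaussDensity_sub`) shows that its
component of degree `k` is
`∑_{|α| = k} ∏_c p_σ(u_c) (α_c)! σ ^ (-α_c) g_{α_c}^σ(u_c) g_{α_c}^τ(X_c)`,
where `g_n^v` is the Hermite polynomial of variance `v` divided by `n!`. This depends on `ε` only
through `σ`, continuously on `σ > 0`, and it makes sense for `ε = 0`. The series of these components
(`heatTerm`, `deltaSeries`) is the heat kernel for `σ > τ` and the delta function for `σ = τ`.

*The norms.* By Mehler's formula in every coordinate, the squared `L²` norms `a_k` of the components
have the generating function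
`∑ a_k q ^ k = ∏_c p_σ(u_c)² (1 - ρ² q²)^{-1/2} exp (u_c² ρ q / (σ (1 + ρ q)))` with `ρ = τ / σ ≤ 1`
(`hasSum_norm_heatTerm_sq_mul_pow`). As `x / (1 + x) ≤ 1 / 2` for `x ≤ 1`, it is at most
`p_σ(u / √2)² (1 - q)^{-d/2}`. The weights `(k + 1) ^ γ` are Gamma integrals of `q ^ k` over
`q = e ^ (-x)`, and the resulting integral converges at `x = 0` exactly when `γ < -d / 2`
(`sum_rpow_mul_le`). This bounds the norm of the series in `𝔻^{2,γ}` by a multiple of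
`p_σ(u / √2)`, uniformly in `σ ≥ τ`. The constant depends on `γ` and `d`, but for a given `γ` only
the finitely many `d < -2γ` occur, so that their constants can be added. For convergence as `ε → 0`,
the components converge one by one, and the bound in `𝔻^{2,γ'}` with `γ < γ' < -d / 2` makes the
tails in `𝔻^{2,γ}` uniformly small (`eventually_sum_rpow_mul_le`, `tendsto_deltaSeries`).

*Mehler's formula.* Convergence of the Mehler series is Bessel's inequality for the heat kernel, and
its sum is found from a linear differential equation that follows from the three-term recurrence
(`tsum_mehlerCoeff_ode`, `hasSum_mehlerCoeff`). For `q = 1` the generating function equals the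
squared `L²` norm of the heat kernel, which is Parseval's identity, so that the expansion converges
in `L²` (`hasSum_heatTerm`).

*The components lie in the chaoses.* The term of degree `k` in `a` of
`exp (⟨a, X⟩ - τ ‖a‖² / 2)` is, up to `k!`, the multiple integral of the symmetric kernel
`∏_l a_{j_l} 1_{(s, t]}(t_l)`. Indeed, along a subdivision of `(s, t]` the off-diagonal sums of
products of `k` increments are integrals of the off-diagonal parts of the kernel, and both errors
are multiples of the mass of the non-injective index tuples, which tends to `0` with the mesh
(`norm_expTerm_sub_sq`, `norm_powerKernel_sub_sq`, `tendsto_sum_not_injective`,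
`isMultipleIntegral_expTerm`). Polarization in `a` yields every product of Hermite polynomials of
the coordinates of `X` (`hermiteRV_mem_chaos`).
-/

namespace WienerChaos

open scoped NNReal ENNReal

/-! ### Divided Hermite polynomials -/

/-- The Hermite polynomial of degree `n` for the Gaussian law of variance `v`, divided by `n!`:
the coefficient of `z ^ n` in `exp (x * z - v * z ^ 2 / 2)`. -/
noncomputable def divHermite (v : ℝ) : ℕ → ℝ → ℝ
  | 0, _ => 1
  | 1, x => x
  | n + 2, x => (x * divHermite v (n + 1) x - v * divHermite v n x) / (n + 2)

@[simp] theorem divHermite_zero (v x : ℝ) : divHermite v 0 x = 1 := by simp [divHermite]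

@[simp] theorem divHermite_one (v x : ℝ) : divHermite v 1 x = x := by simp [divHermite]

theorem divHermite_add_two (v : ℝ) (n : ℕ) (x : ℝ) :
    divHermite v (n + 2) x = (x * divHermite v (n + 1) x - v * divHermite v n x) / (n + 2) := by
  rw [divHermite]

theorem add_two_mul_divHermite (v : ℝ) (n : ℕ) (x : ℝ) :
    (n + 2) * divHermite v (n + 2) x = x * divHermite v (n + 1) x - v * divHermite v n x := by
  rw [divHermite_add_two, mul_div_cancel₀]
  positivity

theorem continuous_divHermite (n : ℕ) : Continuous fun p : ℝ × ℝ => divHermite p.1 n p.2 := by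
  induction n using Nat.twoStepInduction with
  | zero => simpa using continuous_const
  | one => simpa using continuous_snd
  | more n h0 h1 =>
    simp only [divHermite_add_two]
    fun_prop

theorem continuous_divHermite_right (v : ℝ) (n : ℕ) : Continuous (divHermite v n) :=
  (continuous_divHermite n).comp (Continuous.prodMk_right v)

theorem hasDerivAt_divHermite (v : ℝ) (n : ℕ) (x : ℝ) :
    HasDerivAt (divHermite v (n + 1)) (divHermite v n x) x := by
  induction n using Nat.twoStepInduction with
  | zero => simpa [funext (divHermite_one v)] using hasDerivAt_id' x
  | one =>
    have h : divHermite v (1 + 1) = fun x => (x * x - v * 1) / (0 + 2) :=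
      funext fun x => by simpa using divHermite_add_two v 0 x
    rw [h]
    refine ((((hasDerivAt_id' x).mul (hasDerivAt_id' x)).sub_const (v * 1)).div_const
      (0 + 2)).congr_deriv ?_
    simp
  | more n h0 h1 =>
    have h : divHermite v (n + 2 + 1) = fun x =>
        (x * divHermite v (n + 1 + 1) x - v * divHermite v (n + 1) x) / ((n + 1 : ℕ) + 2) :=
      funext fun x => divHermite_add_two v (n + 1) x
    rw [h]
    refine ((((hasDerivAt_id' x).mul h1).sub (h0.const_mul v)).div_const _).congr_deriv ?_
    have h2 := add_two_mul_divHermite v n x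
    rw [div_eq_iff (by positivity)]
    push_cast
    linear_combination -h2

/-- Substituting `a * z` for `z` in the generating series. -/
theorem divHermite_scale (a v : ℝ) (n : ℕ) (x : ℝ) :
    divHermite (a ^ 2 * v) n (a * x) = a ^ n * divHermite v n x := by
  induction n using Nat.twoStepInduction with
  | zero => simp
  | one => simp
  | more n h0 h1 =>
    rw [divHermite_add_two, divHermite_add_two, h0, h1]
    ring

theorem divHermite_zero_variance (n : ℕ) (x : ℝ) :
    divHermite 0 n x = x ^ n / (n.factorial : ℝ) := by
  induction n using Nat.twoStepInduction with
  | zero => simp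
  | one => simp
  | more n _ h1 =>
    rw [divHermite_add_two, h1, Nat.factorial_succ (n + 1)]
    have : ((n + 1).factorial : ℝ) ≠ 0 := by positivity
    push_cast
    field_simp
    ring

/-- The generating series `exp (x * z - v * z ^ 2 / 2)` of the divided Hermite polynomials, as a
formal power series in `z`. -/
noncomputable def hermiteSeries (v x : ℝ) : PowerSeries ℝ :=
  PowerSeries.mk fun n => divHermite v n x

theorem derivative_hermiteSeries (v x : ℝ) :
    PowerSeries.derivative ℝ (hermiteSeries v x) =
      (PowerSeries.C x - PowerSeries.C v * PowerSeries.X) * hermiteSeries v x := by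
  ext n
  rw [PowerSeries.coeff_derivative, sub_mul, map_sub, PowerSeries.coeff_C_mul, mul_assoc,
    PowerSeries.coeff_C_mul]
  cases n with
  | zero => simp [hermiteSeries]
  | succ n =>
    rw [PowerSeries.coeff_succ_X_mul]
    simp only [hermiteSeries, PowerSeries.coeff_mk]
    have := add_two_mul_divHermite v n x
    push_cast
    linear_combination this

/-- A formal power series is determined by its constant term and a linear differential equation
of first order. -/
theorem powerSeries_ext_of_derivative {A F G : PowerSeries ℝ}
    (hF : PowerSeries.derivative ℝ F = A * F) (hG : PowerSeries.derivative ℝ G = A * G)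
    (h0 : PowerSeries.coeff 0 F = PowerSeries.coeff 0 G) : F = G := by
  ext n
  induction n using Nat.strong_induction_on with
  | _ n ih =>
    cases n with
    | zero => exact h0
    | succ n =>
      have hF' := congrArg (PowerSeries.coeff n) hF
      have hG' := congrArg (PowerSeries.coeff n) hG
      rw [PowerSeries.coeff_derivative, PowerSeries.coeff_mul] at hF' hG'
      have h : ∑ p ∈ Finset.HasAntidiagonal.antidiagonal n,
            PowerSeries.coeff p.1 A * PowerSeries.coeff p.2 F =
          ∑ p ∈ Finset.HasAntidiagonal.antidiagonal n,
            PowerSeries.coeff p.1 A * PowerSeries.coeff p.2 G := by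
        refine Finset.sum_congr rfl fun p hp => ?_
        rw [ih p.2 (Nat.lt_succ_of_le (Finset.HasAntidiagonal.antidiagonal.snd_le hp))]
      rw [h, ← hG'] at hF'
      exact mul_right_cancel₀ (by positivity) hF'

/-- The product of two exponentials is an exponential: both sides solve the same differential
equation. -/
theorem hermiteSeries_mul (v w x y : ℝ) :
    hermiteSeries v x * hermiteSeries w y = hermiteSeries (v + w) (x + y) := by
  refine powerSeries_ext_of_derivative (A := PowerSeries.C (x + y) -
    PowerSeries.C (v + w) * PowerSeries.X) ?_ (derivative_hermiteSeries _ _) ?_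
  · rw [Derivation.leibniz, derivative_hermiteSeries, derivative_hermiteSeries]
    simp only [smul_eq_mul, map_add]
    ring
  · simp [hermiteSeries]

theorem hermiteSeries_zero : hermiteSeries 0 0 = 1 := by
  ext n
  rw [hermiteSeries, PowerSeries.coeff_mk, divHermite_zero_variance, PowerSeries.coeff_one]
  cases n <;> simp

theorem prod_hermiteSeries {ι : Type*} (s : Finset ι) (v x : ι → ℝ) :
    ∏ i ∈ s, hermiteSeries (v i) (x i) = hermiteSeries (∑ i ∈ s, v i) (∑ i ∈ s, x i) := by
  classical
  induction s using Finset.induction_on with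
  | empty => simp [hermiteSeries_zero]
  | insert a s ha ih =>
    rw [Finset.prod_insert ha, Finset.sum_insert ha, Finset.sum_insert ha, ih, hermiteSeries_mul]

/-- The addition formula: both sides are coefficients of `∏ exp (x_i z - v_i z² / 2)`. -/
theorem divHermite_sum {ι : Type*} [DecidableEq ι] (s : Finset ι) (v x : ι → ℝ) (k : ℕ) :
    divHermite (∑ i ∈ s, v i) k (∑ i ∈ s, x i) =
      ∑ β ∈ s.finsuppAntidiag k, ∏ i ∈ s, divHermite (v i) (β i) (x i) := by
  have h := congrArg (PowerSeries.coeff k) (prod_hermiteSeries s v x)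
  rw [PowerSeries.coeff_prod] at h
  simpa [hermiteSeries] using h.symm

/-- The addition formula for a linear combination of variables of common variance `v`. -/
theorem divHermite_linear {ι : Type*} [DecidableEq ι] (s : Finset ι) (v : ℝ) (a x : ι → ℝ)
    (k : ℕ) :
    divHermite (v * ∑ i ∈ s, a i ^ 2) k (∑ i ∈ s, a i * x i) =
      ∑ β ∈ s.finsuppAntidiag k,
        (∏ i ∈ s, a i ^ β i) * ∏ i ∈ s, divHermite v (β i) (x i) := by
  rw [Finset.mul_sum, divHermite_sum]
  refine Finset.sum_congr rfl fun β _ => ?_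
  rw [← Finset.prod_mul_distrib]
  refine Finset.prod_congr rfl fun i _ => ?_
  rw [mul_comm v, divHermite_scale]

/-- The multinomial theorem, as the case of variance `0` of the addition formula. -/
theorem sum_finsuppAntidiag_prod_pow_div_factorial {ι : Type*} [DecidableEq ι] (s : Finset ι)
    (y : ι → ℝ) (k : ℕ) :
    ∑ β ∈ s.finsuppAntidiag k, ∏ i ∈ s, y i ^ β i / ((β i).factorial : ℝ) =
      (∑ i ∈ s, y i) ^ k / (k.factorial : ℝ) := by
  have h := divHermite_sum s (fun _ => 0) y k
  simp only [Finset.sum_const_zero, divHermite_zero_variance] at h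
  exact h.symm

/-! ### Gaussian integrals of Hermite polynomials -/

theorem memLp_divHermite (v : ℝ) (w : ℝ≥0) (n : ℕ) (p : ℝ≥0) :
    MemLp (divHermite v n) p (gaussianReal 0 w) := by
  induction n using Nat.twoStepInduction generalizing p with
  | zero => simpa [funext (divHermite_zero v)] using memLp_const (1 : ℝ)
  | one => exact (memLp_id_gaussianReal p).ae_eq (Eventually.of_forall fun x => by simp)
  | more n h0 h1 =>
    have hx : MemLp (fun x : ℝ => x * divHermite v (n + 1) x) p (gaussianReal 0 w) := by
      have : ENNReal.HolderTriple ((2 * p : ℝ≥0) : ℝ≥0∞) ((2 * p : ℝ≥0) : ℝ≥0∞) p := by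
        constructor
        push_cast
        rw [ENNReal.mul_inv (by simp) (by simp), ← add_mul, ENNReal.inv_two_add_inv_two, one_mul]
      exact (h1 (2 * p)).mul' (memLp_id_gaussianReal (2 * p))
    have h : divHermite v (n + 2) = fun x => ((n : ℝ) + 2)⁻¹ *
        (x * divHermite v (n + 1) x - v * divHermite v n x) :=
      funext fun x => by rw [divHermite_add_two, div_eq_inv_mul]
    rw [h]
    exact (hx.sub ((h0 p).const_mul v)).const_mul _

theorem memLp_id_mul_divHermite (v : ℝ) (w : ℝ≥0) (n : ℕ) :
    MemLp (fun x : ℝ => x * divHermite v n x) 2 (gaussianReal 0 w) := by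
  have : ENNReal.HolderTriple ((4 : ℝ≥0) : ℝ≥0∞) ((4 : ℝ≥0) : ℝ≥0∞) 2 := by
    constructor
    have : ((4 : ℝ≥0) : ℝ≥0∞) = 2 * 2 := by norm_num
    rw [this, ENNReal.mul_inv (by simp) (by simp), ← add_mul, ENNReal.inv_two_add_inv_two, one_mul]
  exact (memLp_divHermite v w n 4).mul' (memLp_id_gaussianReal 4)

theorem memLp_two_divHermite (v : ℝ) (w : ℝ≥0) (n : ℕ) :
    MemLp (divHermite v n) 2 (gaussianReal 0 w) := memLp_divHermite v w n 2

/-- Gaussian integration by parts. -/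
theorem integral_id_mul_gaussianReal {v : ℝ≥0} (hv : v ≠ 0) {g g' : ℝ → ℝ}
    (hg : ∀ x, HasDerivAt g (g' x) x) (h1 : Integrable g (gaussianReal 0 v))
    (h2 : Integrable g' (gaussianReal 0 v))
    (h3 : Integrable (fun x => x * g x) (gaussianReal 0 v)) :
    ∫ x, x * g x ∂gaussianReal 0 v = v * ∫ x, g' x ∂gaussianReal 0 v := by
  have hv' : (v : ℝ) ≠ 0 := by exact_mod_cast hv
  have key : ∀ f : ℝ → ℝ, Integrable f (gaussianReal 0 v) →
      Integrable (fun x => gaussianPDFReal 0 v x * f x) := by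
    intro f hf
    rw [gaussianReal_of_var_ne_zero 0 hv, integrable_withDensity_iff_integrable_smul₀'
      (measurable_gaussianPDF 0 v).aemeasurable
      (Eventually.of_forall fun x => gaussianPDF_lt_top)] at hf
    simpa using hf
  have hd : ∀ x, HasDerivAt (gaussianPDFReal 0 v) (-(x / v) * gaussianPDFReal 0 v x) x := by
    intro x
    have h : HasDerivAt (fun x : ℝ => -(x - 0) ^ 2 / (2 * (v : ℝ))) (-(x / v)) x := by
      refine ((((hasDerivAt_id' x).sub_const 0).pow 2).neg.div_const _).congr_deriv ?_
      field_simp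
      simp [mul_comm]
    have h' := (h.exp.const_mul (√(2 * Real.pi * v))⁻¹)
    refine (h'.congr_deriv ?_)
    rw [gaussianPDFReal]
    ring
  have hI := integral_eq_zero_of_hasDerivAt_of_integrable
    (f := fun x => gaussianPDFReal 0 v x * g x)
    (f' := fun x => gaussianPDFReal 0 v x * g' x - (v : ℝ)⁻¹ *
      (gaussianPDFReal 0 v x * (x * g x)))
    (fun x => ((hd x).mul (hg x)).congr_deriv (by ring))
    ((key _ h2).sub ((key _ h3).const_mul _)) (key _ h1)
  rw [integral_sub (key _ h2) ((key _ h3).const_mul _), integral_const_mul] at hI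
  rw [integral_gaussianReal_eq_integral_smul hv, integral_gaussianReal_eq_integral_smul hv]
  simp only [smul_eq_mul]
  rw [sub_eq_zero] at hI
  rw [hI, mul_inv_cancel_left₀ hv']

/-- Integration by parts against a Hermite polynomial lowers its degree. -/
theorem integral_divHermite_succ_mul {v : ℝ≥0} (hv : v ≠ 0) {f f' : ℝ → ℝ} (n : ℕ)
    (hf : ∀ x, HasDerivAt f (f' x) x) (h1 : MemLp f 2 (gaussianReal 0 v))
    (h2 : MemLp f' 2 (gaussianReal 0 v)) :
    (n + 1) * ∫ x, divHermite v (n + 1) x * f x ∂gaussianReal 0 v =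
      v * ∫ x, divHermite v n x * f' x ∂gaussianReal 0 v := by
  have hi : ∀ m, Integrable (fun x => divHermite v m x * f x) (gaussianReal 0 v) := fun m =>
    (memLp_two_divHermite v v m).integrable_mul h1
  have hi' : ∀ m, Integrable (fun x => divHermite v m x * f' x) (gaussianReal 0 v) := fun m =>
    (memLp_two_divHermite v v m).integrable_mul h2
  have hx : ∀ m, Integrable (fun x => x * (divHermite v m x * f x)) (gaussianReal 0 v) :=
    fun m => by
    refine ((memLp_id_mul_divHermite v v m).integrable_mul h1).congr
      (Eventually.of_forall fun x => ?_)
    simp [mul_assoc]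
  cases n with
  | zero =>
    have := integral_id_mul_gaussianReal hv hf (by simpa using hi 0) (by simpa using hi' 0)
      (by simpa using hx 0)
    simpa using this
  | succ n =>
    have h := integral_id_mul_gaussianReal hv (g := fun x => divHermite v (n + 1) x * f x)
      (fun x => (hasDerivAt_divHermite v n x).mul (hf x)) (hi _) ((hi _).add (hi' _)) (hx _)
    rw [integral_add (hi n) (hi' (n + 1))] at h
    have e : ∀ x, ((n + 1 : ℕ) + 1 : ℝ) * (divHermite v (n + 1 + 1) x * f x) =
        x * (divHermite v (n + 1) x * f x) - v * (divHermite v n x * f x) := fun x => by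
      have := add_two_mul_divHermite v n x
      push_cast
      linear_combination f x * this
    rw [← integral_const_mul, integral_congr_ae (Eventually.of_forall e),
      integral_sub (hx _) ((hi _).const_mul _), integral_const_mul, h]
    ring

/-- Orthogonality: integration by parts lowers both degrees until one of them is `0`. -/
theorem integral_divHermite_mul_divHermite {v : ℝ≥0} (hv : v ≠ 0) (n m : ℕ) :
    ∫ x, divHermite v n x * divHermite v m x ∂gaussianReal 0 v =
      if n = m then (v : ℝ) ^ n / (n.factorial : ℝ) else 0 := by
  have h0 : ∀ n : ℕ, ∫ x, divHermite v (n + 1) x ∂gaussianReal 0 v = 0 := fun n => by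
    have := integral_divHermite_succ_mul hv n (fun x => hasDerivAt_const x (1 : ℝ))
      (memLp_const 1) (memLp_const 0)
    simp only [mul_one, mul_zero, integral_zero] at this
    exact (mul_eq_zero.1 this).resolve_left (by positivity)
  induction n generalizing m with
  | zero => cases m <;> simp [h0]
  | succ n ih =>
    cases m with
    | zero => simp [h0]
    | succ m =>
      have := integral_divHermite_succ_mul hv n (hasDerivAt_divHermite v m)
        (memLp_two_divHermite v v _) (memLp_two_divHermite v v _)
      rw [ih] at this
      have hn : (n + 1 : ℝ) ≠ 0 := by positivity
      rw [← mul_right_inj' hn, this]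
      by_cases h : n = m
      · simp only [h, if_true, Nat.factorial_succ, pow_succ]
        have : (m.factorial : ℝ) ≠ 0 := by positivity
        push_cast
        field_simp
      · simp [h]

/-! ### Orthogonal expansions in Hilbert spaces -/

section Hilbert

variable {E : Type*} [NormedAddCommGroup E] [InnerProductSpace ℝ E] {ι : Type*}

theorem norm_sum_sq_of_orthogonal {X : ι → E} (hX : Pairwise fun i j => inner ℝ (X i) (X j) = 0)
    (S : Finset ι) : ‖∑ i ∈ S, X i‖ ^ 2 = ∑ i ∈ S, ‖X i‖ ^ 2 := by
  classical
  rw [← real_inner_self_eq_norm_sq, sum_inner]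
  refine Finset.sum_congr rfl fun i hi => ?_
  rw [inner_sum, Finset.sum_eq_single_of_mem i hi fun j _ hj => hX hj.symm,
    real_inner_self_eq_norm_sq]

/-- The condition `⟪f, X i⟫ = ‖X i‖ ^ 2` says that `X i` is the orthogonal projection of `f`
onto the line it spans. -/
theorem norm_sub_sum_sq_of_orthogonal {X : ι → E} {f : E}
    (hX : Pairwise fun i j => inner ℝ (X i) (X j) = 0)
    (hf : ∀ i, inner ℝ f (X i) = ‖X i‖ ^ 2) (S : Finset ι) :
    ‖f - ∑ i ∈ S, X i‖ ^ 2 = ‖f‖ ^ 2 - ∑ i ∈ S, ‖X i‖ ^ 2 := by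
  rw [norm_sub_sq_real, norm_sum_sq_of_orthogonal hX, inner_sum,
    Finset.sum_congr rfl fun i _ => hf i]
  ring

/-- Bessel's inequality. -/
theorem sum_norm_sq_le_of_orthogonal {X : ι → E} {f : E}
    (hX : Pairwise fun i j => inner ℝ (X i) (X j) = 0)
    (hf : ∀ i, inner ℝ f (X i) = ‖X i‖ ^ 2) (S : Finset ι) :
    ∑ i ∈ S, ‖X i‖ ^ 2 ≤ ‖f‖ ^ 2 := by
  have h := norm_sub_sum_sq_of_orthogonal hX hf S
  nlinarith [sq_nonneg ‖f - ∑ i ∈ S, X i‖]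

/-- Parseval's identity implies convergence of the orthogonal expansion. -/
theorem hasSum_of_hasSum_norm_sq {X : ι → E} {f : E}
    (hX : Pairwise fun i j => inner ℝ (X i) (X j) = 0)
    (hf : ∀ i, inner ℝ f (X i) = ‖X i‖ ^ 2) (h : HasSum (fun i => ‖X i‖ ^ 2) (‖f‖ ^ 2)) :
    HasSum X f := by
  rw [HasSum, tendsto_iff_norm_sub_tendsto_zero]
  have h1 : Tendsto (fun S : Finset ι => ‖f - ∑ i ∈ S, X i‖ ^ 2) atTop (𝓝 0) := by
    simp only [norm_sub_sum_sq_of_orthogonal hX hf]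
    rw [← sub_self (‖f‖ ^ 2)]
    exact tendsto_const_nhds.sub h
  have h2 := (Real.continuous_sqrt.tendsto 0).comp h1
  simp only [Real.sqrt_zero] at h2
  refine h2.congr fun S => ?_
  rw [Function.comp_apply, Real.sqrt_sq (norm_nonneg _), norm_sub_rev]

theorem inner_toLp {α : Type*} [MeasurableSpace α] {μ : Measure α} {f g : α → ℝ}
    (hf : MemLp f 2 μ) (hg : MemLp g 2 μ) :
    inner ℝ (hf.toLp f) (hg.toLp g) = ∫ x, f x * g x ∂μ := by
  rw [L2.inner_def]
  refine integral_congr_ae ?_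
  filter_upwards [hf.coeFn_toLp, hg.coeFn_toLp] with x h1 h2
  rw [h1, h2, real_inner_eq_re_inner]
  simp [mul_comm]

end Hilbert

/-! ### The one-dimensional heat kernel -/

/-- The centred Gaussian density of variance `v` on the real line. -/
noncomputable def gaussDensity (v x : ℝ) : ℝ :=
  (√(2 * Real.pi * v))⁻¹ * Real.exp (-x ^ 2 / (2 * v))

theorem gaussDensity_pos {v : ℝ} (hv : 0 < v) (x : ℝ) : 0 < gaussDensity v x := by
  have := Real.pi_pos
  unfold gaussDensity
  positivity

theorem gaussDensity_le {v : ℝ} (hv : 0 < v) (x : ℝ) :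
    gaussDensity v x ≤ (√(2 * Real.pi * v))⁻¹ := by
  refine mul_le_of_le_one_right (by positivity) (Real.exp_le_one_iff.2 ?_)
  rw [neg_div]
  exact neg_nonpos.2 (by positivity)

theorem continuous_gaussDensity (v : ℝ) : Continuous (gaussDensity v) := by
  unfold gaussDensity
  fun_prop

theorem hasDerivAt_gaussDensity_sub {v : ℝ} (hv : 0 < v) (u x : ℝ) :
    HasDerivAt (fun x => gaussDensity v (x - u)) (-((x - u) / v) * gaussDensity v (x - u)) x := by
  have h : HasDerivAt (fun x : ℝ => -(x - u) ^ 2 / (2 * v)) (-((x - u) / v)) x := by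
    refine ((((hasDerivAt_id' x).sub_const u).pow 2).neg.div_const _).congr_deriv ?_
    field_simp
    simp
    ring
  refine (h.exp.const_mul (√(2 * Real.pi * v))⁻¹).congr_deriv ?_
  rw [gaussDensity]
  ring

theorem memLp_gaussDensity_sub {ε : ℝ} (hε : 0 < ε) (u : ℝ) (v : ℝ≥0) (p : ℝ≥0∞) :
    MemLp (fun x => gaussDensity ε (x - u)) p (gaussianReal 0 v) := by
  refine MemLp.of_bound ((continuous_gaussDensity ε).comp
    (continuous_id.sub continuous_const)).aestronglyMeasurable (√(2 * Real.pi * ε))⁻¹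
    (Eventually.of_forall fun x => ?_)
  rw [Real.norm_of_nonneg (gaussDensity_pos hε _).le]
  exact gaussDensity_le hε _

theorem memLp_id_mul_gaussDensity_sub {ε : ℝ} (hε : 0 < ε) (u : ℝ) (v : ℝ≥0) :
    MemLp (fun x => x * gaussDensity ε (x - u)) 2 (gaussianReal 0 v) := by
  have h : MemLp (fun x : ℝ => x) 2 (gaussianReal 0 v) := memLp_id_gaussianReal 2
  exact (memLp_gaussDensity_sub hε u v ∞).mul' h

/-- The convolution of two centred Gaussian densities adds the variances. -/
theorem integral_gaussDensity_sub {v : ℝ≥0} (hv : v ≠ 0) {ε : ℝ} (hε : 0 < ε) (u : ℝ) :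
    ∫ x, gaussDensity ε (x - u) ∂gaussianReal 0 v = gaussDensity (v + ε) u := by
  have hv' : 0 < (v : ℝ) := by exact_mod_cast pos_iff_ne_zero.2 hv
  have hσ : 0 < (v : ℝ) + ε := by positivity
  -- completing the square in the product of the two densities
  let w : ℝ≥0 := ⟨v * ε / (v + ε), by positivity⟩
  have hw : w ≠ 0 := by
    rw [← NNReal.coe_ne_zero]
    change v * ε / (v + ε) ≠ 0
    positivity
  have e : ∀ x, gaussianPDFReal 0 v x • gaussDensity ε (x - u) =
      gaussDensity (v + ε) u * gaussianPDFReal (u * v / (v + ε)) w x := by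
    intro x
    have hc : (√(2 * Real.pi * v))⁻¹ * (√(2 * Real.pi * ε))⁻¹ =
        (√(2 * Real.pi * (v + ε)))⁻¹ * (√(2 * Real.pi * w))⁻¹ := by
      rw [← mul_inv, ← mul_inv, ← Real.sqrt_mul (by positivity), ← Real.sqrt_mul (by positivity)]
      congr 2
      change _ = 2 * Real.pi * (v + ε) * (2 * Real.pi * (v * ε / (v + ε)))
      field_simp
    have he : Real.exp (-(x - 0) ^ 2 / (2 * v)) * Real.exp (-(x - u) ^ 2 / (2 * ε)) =
        Real.exp (-u ^ 2 / (2 * (v + ε))) *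
          Real.exp (-(x - u * v / (v + ε)) ^ 2 / (2 * (w : ℝ))) := by
      rw [← Real.exp_add, ← Real.exp_add]
      congr 1
      change _ = -u ^ 2 / (2 * (v + ε)) +
        -(x - u * v / (v + ε)) ^ 2 / (2 * (v * ε / (v + ε)))
      field_simp
      ring
    simp only [smul_eq_mul, gaussianPDFReal, gaussDensity]
    rw [mul_mul_mul_comm, hc, he]
    ring
  rw [integral_gaussianReal_eq_integral_smul hv, integral_congr_ae (Eventually.of_forall e),
    integral_const_mul, integral_gaussianPDFReal_eq_one _ hw, mul_one]

/-- The Hermite coefficients of the heat kernel: integration by parts turns the three-term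
recurrence of variance `v` into the one of variance `v + ε`. -/
theorem integral_divHermite_mul_gaussDensity_sub {v : ℝ≥0} (hv : v ≠ 0) {ε : ℝ} (hε : 0 < ε)
    (u : ℝ) (n : ℕ) :
    ∫ x, divHermite v n x * gaussDensity ε (x - u) ∂gaussianReal 0 v =
      gaussDensity (v + ε) u * ((v / (v + ε)) ^ n * divHermite (v + ε) n u) := by
  have hv' : 0 < (v : ℝ) := by exact_mod_cast pos_iff_ne_zero.2 hv
  have hσ : 0 < (v : ℝ) + ε := by positivity
  have hf := memLp_gaussDensity_sub hε u v 2
  have hxf := memLp_id_mul_gaussDensity_sub hε u v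
  have hi : ∀ m, Integrable (fun x => divHermite v m x * gaussDensity ε (x - u))
    (gaussianReal 0 v) := fun m => (memLp_two_divHermite v v m).integrable_mul hf
  have hxi : ∀ m, Integrable (fun x => divHermite v m x * (x * gaussDensity ε (x - u)))
    (gaussianReal 0 v) := fun m => (memLp_two_divHermite v v m).integrable_mul hxf
  have hf' : MemLp (fun x => -((x - u) / ε) * gaussDensity ε (x - u)) 2 (gaussianReal 0 v) := by
    refine ((hf.const_mul (u / ε)).sub (hxf.const_mul ε⁻¹)).ae_eq
      (Eventually.of_forall fun x => ?_)
    simp only [Pi.sub_apply]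
    field_simp
    ring
  -- the integration by parts formula, with the derivative of the heat kernel written out
  have step : ∀ m : ℕ, (m + 1) * ∫ x, divHermite v (m + 1) x * gaussDensity ε (x - u)
      ∂gaussianReal 0 v = v / ε * (u * (∫ x, divHermite v m x * gaussDensity ε (x - u)
      ∂gaussianReal 0 v) - ∫ x, divHermite v m x * (x * gaussDensity ε (x - u))
      ∂gaussianReal 0 v) := by
    intro m
    rw [integral_divHermite_succ_mul hv m (fun x => hasDerivAt_gaussDensity_sub hε u x) hf hf',
      ← integral_const_mul u, ← integral_sub ((hi m).const_mul u) (hxi m), div_eq_mul_inv,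
      mul_assoc, ← integral_const_mul (ε⁻¹)]
    congr 1
    refine integral_congr_ae (Eventually.of_forall fun x => ?_)
    simp only
    field_simp
    ring
  induction n using Nat.twoStepInduction with
  | zero => simpa using integral_gaussDensity_sub hv hε u
  | one =>
    have h := step 0
    simp only [divHermite_zero, one_mul, zero_add, divHermite_one, Nat.cast_zero] at h
    rw [integral_gaussDensity_sub hv hε u] at h
    simp only [divHermite_one, pow_one]
    field_simp at h ⊢
    linear_combination h
  | more n h0 h1 =>
    have h := step (n + 1)
    have e : ∀ x, divHermite v (n + 1) x * (x * gaussDensity ε (x - u)) =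
        (n + 2) * (divHermite v (n + 1 + 1) x * gaussDensity ε (x - u)) +
          v * (divHermite v n x * gaussDensity ε (x - u)) := fun x => by
      linear_combination -gaussDensity ε (x - u) * add_two_mul_divHermite v n x
    rw [integral_congr_ae (Eventually.of_forall e),
      integral_add ((hi _).const_mul _) ((hi _).const_mul _), integral_const_mul,
      integral_const_mul, h0, h1] at h
    have hn : (n + 2 : ℝ) ≠ 0 := by positivity
    rw [← mul_right_inj' hn]
    have hr := add_two_mul_divHermite (v + ε) n u
    have h2 : (n + 2) * ((v + ε) / ε) * ∫ x, divHermite v (n + 2) x * gaussDensity ε (x - u)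
      ∂gaussianReal 0 v = v / ε * (u * (gaussDensity (v + ε) u *
        ((v / (v + ε)) ^ (n + 1) * divHermite (v + ε) (n + 1) u)) - v * (gaussDensity (v + ε) u *
        ((v / (v + ε)) ^ n * divHermite (v + ε) n u))) := by
      have : ((v : ℝ) + ε) / ε = 1 + v / ε := by field_simp; ring
      rw [this]
      push_cast at h
      linear_combination h
    have h3 : (n + 2 : ℝ) * ∫ x, divHermite v (n + 2) x * gaussDensity ε (x - u)
        ∂gaussianReal 0 v = v / (v + ε) * (u * (gaussDensity (v + ε) u *
        ((v / (v + ε)) ^ (n + 1) * divHermite (v + ε) (n + 1) u)) - v * (gaussDensity (v + ε) u *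
        ((v / (v + ε)) ^ n * divHermite (v + ε) n u))) := by
      field_simp at h2 ⊢
      linear_combination h2
    rw [h3]
    have hρ : (v : ℝ) = v / (v + ε) * (v + ε) := by field_simp
    generalize (v : ℝ) / (v + ε) = ρ at *
    generalize gaussDensity (v + ε) u = p at *
    rw [pow_succ, pow_succ]
    have hv2 : (v : ℝ) * (ρ ^ n * divHermite (v + ε) n u) =
      ρ * ρ ^ n * ((v + ε) * divHermite (v + ε) n u) := by
      nth_rewrite 1 [hρ]; ring
    linear_combination -ρ * p * hv2 - ρ ^ 2 * ρ ^ n * p * hr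

theorem gaussDensity_sq {ε : ℝ} (hε : 0 < ε) (x : ℝ) :
    gaussDensity ε x ^ 2 = gaussDensity (2 * ε) 0 * gaussDensity (ε / 2) x := by
  have hc : ((√(2 * Real.pi * ε))⁻¹) ^ 2 =
      (√(2 * Real.pi * (2 * ε)))⁻¹ * (√(2 * Real.pi * (ε / 2)))⁻¹ := by
    have := Real.pi_pos
    rw [inv_pow, Real.sq_sqrt (by positivity), ← mul_inv, ← Real.sqrt_mul (by positivity)]
    congr 1
    rw [eq_comm, Real.sqrt_eq_iff_mul_self_eq (by positivity) (by positivity)]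
    ring
  unfold gaussDensity
  rw [mul_pow, hc, ← Real.exp_nat_mul]
  have : ((2 : ℕ) : ℝ) * (-x ^ 2 / (2 * ε)) = -x ^ 2 / (2 * (ε / 2)) := by
    push_cast
    field_simp
  rw [this]
  simp
  ring

theorem integral_gaussDensity_sub_sq {v : ℝ≥0} (hv : v ≠ 0) {ε : ℝ} (hε : 0 < ε) (u : ℝ) :
    ∫ x, gaussDensity ε (x - u) ^ 2 ∂gaussianReal 0 v =
      gaussDensity (2 * ε) 0 * gaussDensity (v + ε / 2) u := by
  simp only [gaussDensity_sq hε]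
  rw [integral_const_mul, integral_gaussDensity_sub hv (by positivity)]

/-! ### Mehler's formula on the diagonal -/

/-- The terms `n! g_n(y)²` of the Mehler series, where `g_n` is the divided Hermite polynomial. -/
noncomputable def mehlerCoeff (v y : ℝ) (n : ℕ) : ℝ :=
  (n.factorial : ℝ) * divHermite v n y ^ 2

theorem mehlerCoeff_nonneg (v y : ℝ) (n : ℕ) : 0 ≤ mehlerCoeff v y n := by
  unfold mehlerCoeff
  positivity

/-- Convergence of the Mehler series. With `r = v / σ²` and `p` the heat kernel of variance
`σ - v`, the terms are the squared Hermite coefficients of `p` under the Gaussian law of variance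
`v`, so that Bessel's inequality applies. -/
theorem summable_mehlerCoeff {σ r : ℝ} (hσ : 0 < σ) (hr : 0 ≤ r) (hr1 : σ * r < 1) (y : ℝ) :
    Summable fun n => mehlerCoeff σ y n * r ^ n := by
  wlog hr0 : 0 < r generalizing r
  · have h : r = 0 := le_antisymm (not_lt.1 hr0) hr
    subst h
    refine summable_of_ne_finset_zero (s := {0}) fun n hn => ?_
    simp [zero_pow (by simpa using hn : n ≠ 0)]
  let v : ℝ≥0 := ⟨r * σ ^ 2, by positivity⟩
  have hvr : (v : ℝ) = r * σ ^ 2 := rfl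
  have hv : v ≠ 0 := by
    rw [← NNReal.coe_ne_zero, hvr]
    positivity
  have hvσ : (v : ℝ) < σ := by
    rw [hvr]
    nlinarith
  have hε : 0 < σ - v := by linarith
  let G : ℕ → Lp ℝ 2 (gaussianReal 0 v) := fun n => (memLp_two_divHermite v v n).toLp _
  let f : Lp ℝ 2 (gaussianReal 0 v) := (memLp_gaussDensity_sub hε y v 2).toLp _
  have hGG : ∀ n m, inner ℝ (G n) (G m) = if n = m then (v : ℝ) ^ n / (n.factorial : ℝ) else 0 :=
    fun n m => by rw [inner_toLp, integral_divHermite_mul_divHermite hv]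
  have hGn : ∀ n, ‖G n‖ ^ 2 = (v : ℝ) ^ n / (n.factorial : ℝ) := fun n => by
    rw [← real_inner_self_eq_norm_sq, hGG, if_pos rfl]
  have hfG : ∀ n, inner ℝ f (G n) = gaussDensity σ y * ((v / σ) ^ n * divHermite σ n y) :=
    fun n => by
      rw [real_inner_comm, inner_toLp, integral_divHermite_mul_gaussDensity_sub hv hε]
      simp
  have hv0 : 0 < (v : ℝ) := by exact_mod_cast pos_iff_ne_zero.2 hv
  let c : ℕ → ℝ := fun n => gaussDensity σ y * ((n.factorial : ℝ) / σ ^ n * divHermite σ n y)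
  have hfc : ∀ n, inner ℝ f (c n • G n) = ‖c n • G n‖ ^ 2 := fun n => by
    rw [inner_smul_right, norm_smul, mul_pow, hGn, hfG, Real.norm_eq_abs, sq_abs]
    simp only [c]
    have : (n.factorial : ℝ) ≠ 0 := by positivity
    rw [div_pow]
    field_simp
  have hcn : ∀ n, ‖c n • G n‖ ^ 2 = gaussDensity σ y ^ 2 * (mehlerCoeff σ y n * r ^ n) :=
      fun n => by
    rw [norm_smul, mul_pow, hGn, Real.norm_eq_abs, sq_abs, hvr]
    simp only [c, mehlerCoeff]
    have : (n.factorial : ℝ) ≠ 0 := by positivity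
    field_simp
    ring
  have horth : Pairwise fun i j => inner ℝ (c i • G i) (c j • G j) = 0 := fun i j hij => by
    simp [inner_smul_left, inner_smul_right, hGG, hij]
  have hp := (gaussDensity_pos hσ y).ne'
  have hs : Summable fun n => gaussDensity σ y ^ 2 * (mehlerCoeff σ y n * r ^ n) := by
    refine summable_of_sum_le (c := ‖f‖ ^ 2) (fun n => ?_) fun S => ?_
    · have := mehlerCoeff_nonneg σ y n
      positivity
    · simpa only [hcn] using sum_norm_sq_le_of_orthogonal horth hfc S
  exact (summable_mul_left_iff (pow_ne_zero 2 hp)).1 hs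

/-- The mean value inequality for `x ^ (n + 1)`. -/
theorem succ_mul_pow_mul_sub_le {R R' : ℝ} (hR : 0 ≤ R) (h : R ≤ R') (n : ℕ) :
    ((n : ℝ) + 1) * R ^ n * (R' - R) ≤ R' ^ (n + 1) - R ^ (n + 1) := by
  induction n with
  | zero => simp
  | succ n ih =>
    have h1 : R ^ (n + 1) ≤ R' ^ (n + 1) := pow_le_pow_left₀ hR h _
    have h2 := mul_le_mul_of_nonneg_left ih hR
    have h3 := mul_le_mul_of_nonneg_right h1 (sub_nonneg.2 h)
    push_cast
    rw [pow_succ R (n + 1), pow_succ R' (n + 1)]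
    rw [pow_succ R n] at *
    nlinarith

theorem summable_succ_mul_mehlerCoeff {σ r : ℝ} (hσ : 0 < σ) (hr : 0 ≤ r) (hr1 : σ * r < 1)
    (y : ℝ) : Summable fun n : ℕ => ((n : ℝ) + 1) * mehlerCoeff σ y n * r ^ n := by
  -- the factor `n + 1` is absorbed by a slightly larger radius `q`
  obtain ⟨q, hq, hq1⟩ : ∃ q, r < q ∧ σ * q < 1 := by
    refine ⟨(r + 1 / σ) / 2, ?_, ?_⟩
    · have : r < 1 / σ := by rw [lt_div_iff₀ hσ]; linarith
      linarith
    · field_simp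
      linarith
  have hq0 : 0 < q - r := sub_pos.2 hq
  refine Summable.of_nonneg_of_le (fun n => ?_) (fun n => ?_)
    ((summable_mehlerCoeff hσ (hr.trans hq.le) hq1 y).mul_left (q / (q - r)))
  · have := mehlerCoeff_nonneg σ y n
    positivity
  · have h := succ_mul_pow_mul_sub_le hr hq.le n
    have h2 : ((n : ℝ) + 1) * r ^ n ≤ q / (q - r) * q ^ n := by
      rw [div_mul_eq_mul_div, le_div_iff₀ hq0, ← pow_succ']
      have : 0 ≤ r ^ (n + 1) := by positivity
      linarith
    calc ((n : ℝ) + 1) * mehlerCoeff σ y n * r ^ n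
        = mehlerCoeff σ y n * (((n : ℝ) + 1) * r ^ n) := by ring
      _ ≤ mehlerCoeff σ y n * (q / (q - r) * q ^ n) :=
          mul_le_mul_of_nonneg_left h2 (mehlerCoeff_nonneg _ _ _)
      _ = _ := by ring

theorem mul_abs_lt_one {σ r : ℝ} (hσ : 0 < σ) (h : |σ * r| < 1) : σ * |r| < 1 := by
  rwa [abs_mul, abs_of_pos hσ] at h

theorem summable_succ_mul_mehlerCoeff_of_abs {σ r : ℝ} (hσ : 0 < σ) (h : |σ * r| < 1) (y : ℝ) :
    Summable fun n : ℕ => ((n : ℝ) + 1) * mehlerCoeff σ y n * r ^ n := by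
  refine Summable.of_norm ((summable_succ_mul_mehlerCoeff hσ (abs_nonneg r)
    (mul_abs_lt_one hσ h) y).congr fun n => ?_)
  rw [norm_mul, norm_pow, Real.norm_eq_abs r,
    Real.norm_of_nonneg (mul_nonneg (by positivity) (mehlerCoeff_nonneg _ _ _))]

theorem summable_mehlerCoeff_of_abs {σ r : ℝ} (hσ : 0 < σ) (h : |σ * r| < 1) (y : ℝ) :
    Summable fun n : ℕ => mehlerCoeff σ y n * r ^ n := by
  refine Summable.of_norm ((summable_mehlerCoeff hσ (abs_nonneg r)
    (mul_abs_lt_one hσ h) y).congr fun n => ?_)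
  rw [norm_mul, norm_pow, Real.norm_eq_abs, Real.norm_eq_abs,
    abs_of_nonneg (mehlerCoeff_nonneg σ y n)]

theorem hasDerivAt_tsum_mehlerCoeff {σ r : ℝ} (hσ : 0 < σ) (h : |σ * r| < 1) (y : ℝ) :
    HasDerivAt (fun r => ∑' n, mehlerCoeff σ y n * r ^ n)
      (∑' n : ℕ, ((n : ℝ) + 1) * mehlerCoeff σ y (n + 1) * r ^ n) r := by
  obtain ⟨q, hq, hq1⟩ : ∃ q, |r| < q ∧ σ * q < 1 := by
    have := mul_abs_lt_one hσ h
    refine ⟨(|r| + 1 / σ) / 2, ?_, ?_⟩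
    · have : |r| < 1 / σ := by rw [lt_div_iff₀ hσ]; linarith
      linarith
    · field_simp
      linarith
  have hq0 : 0 < q := (abs_nonneg r).trans_lt hq
  -- the derived series at the radius `q` dominates the derivatives of the terms
  have hs : Summable fun n : ℕ => mehlerCoeff σ y n * (n * q ^ (n - 1)) := by
    refine Summable.of_nonneg_of_le (fun n => ?_) (fun n => ?_)
      ((summable_succ_mul_mehlerCoeff hσ hq0.le hq1 y).mul_left q⁻¹)
    · have := mehlerCoeff_nonneg σ y n
      positivity
    · have hc := mehlerCoeff_nonneg σ y n
      cases n with
      | zero => simp; positivity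
      | succ n =>
        have e : q⁻¹ * ((((n + 1 : ℕ) : ℝ) + 1) * mehlerCoeff σ y (n + 1) * q ^ (n + 1)) =
            mehlerCoeff σ y (n + 1) * ((((n + 1 : ℕ) : ℝ) + 1) * q ^ n) := by
          field_simp
          ring
        rw [e, Nat.add_sub_cancel]
        gcongr
        linarith
  have hd := hasDerivAt_tsum_of_isPreconnected (t := Set.Ioo (-q) q) (y₀ := 0) (y := r)
    (g := fun n r => mehlerCoeff σ y n * r ^ n)
    (g' := fun n r => mehlerCoeff σ y n * (n * r ^ (n - 1))) hs isOpen_Ioo isPreconnected_Ioo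
    (fun n x _ => (hasDerivAt_pow n x).const_mul _)
    (fun n x hx => by
      rw [norm_mul, norm_mul, norm_pow, Real.norm_of_nonneg (mehlerCoeff_nonneg _ _ _),
        Real.norm_of_nonneg (Nat.cast_nonneg n)]
      have := mehlerCoeff_nonneg σ y n
      have hx' : ‖x‖ ≤ q := (abs_lt.2 hx).le
      gcongr)
    (by simp [hq0]) (summable_mehlerCoeff hσ le_rfl (by simp) y) (abs_lt.1 hq)
  refine hd.congr_deriv ?_
  have hs' : Summable fun n : ℕ => mehlerCoeff σ y n * (n * r ^ (n - 1)) :=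
    Summable.of_norm_bounded hs fun n => by
      rw [norm_mul, norm_mul, norm_pow, Real.norm_of_nonneg (mehlerCoeff_nonneg _ _ _),
        Real.norm_of_nonneg (Nat.cast_nonneg n)]
      have := mehlerCoeff_nonneg σ y n
      have hx' : ‖r‖ ≤ q := hq.le
      gcongr
  rw [hs'.tsum_eq_zero_add]
  simp only [Nat.cast_zero, zero_mul, mul_zero, zero_add, Nat.add_sub_cancel]
  refine tsum_congr fun n => ?_
  push_cast
  ring

/-- The differential equation of the Mehler series `A`. With `B = ∑ (n+1)! g_n g_{n+1} r^n` and
`D = ∑ (n+2)! g_n g_{n+2} r^n`, the three-term recurrence gives `B = y A - σ r B`,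
`A' = y B - σ r D` and `D = y B - σ (r A' + A)`. -/
theorem tsum_mehlerCoeff_ode {σ r : ℝ} (hσ : 0 < σ) (h : |σ * r| < 1) (y : ℝ) :
    (1 + σ * r) * (1 - (σ * r) ^ 2) *
        ∑' n : ℕ, ((n : ℝ) + 1) * mehlerCoeff σ y (n + 1) * r ^ n =
      (y ^ 2 * (1 - σ * r) + (1 + σ * r) * (σ ^ 2 * r)) * ∑' n, mehlerCoeff σ y n * r ^ n := by
  let g := fun n => divHermite σ n y
  have hg : ∀ n : ℕ, ((n : ℝ) + 2) * g (n + 2) = y * g (n + 1) - σ * g n := fun n =>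
    add_two_mul_divHermite σ n y
  have hg0 : g 0 = 1 := divHermite_zero σ y
  have hg1 : g 1 = y := divHermite_one σ y
  have ha : ∀ n, mehlerCoeff σ y n = (n.factorial : ℝ) * g n ^ 2 := fun n => rfl
  let b : ℕ → ℝ := fun n => ((n + 1).factorial : ℝ) * (g n * g (n + 1))
  have hfac : ∀ n : ℕ, ((n + 1).factorial : ℝ) = (n + 1) * n.factorial := fun n => by
    rw [Nat.factorial_succ]; push_cast; ring
  have sE := summable_succ_mul_mehlerCoeff_of_abs hσ h y
  have sA := summable_mehlerCoeff_of_abs hσ h y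
  have sA1 : Summable fun n : ℕ => mehlerCoeff σ y (n + 1) * r ^ n := by
    by_cases hr : r = 0
    · refine summable_of_ne_finset_zero (s := {0}) fun n hn => ?_
      simp [hr, zero_pow (by simpa using hn : n ≠ 0)]
    · refine (((summable_nat_add_iff 1).2 sA).mul_left r⁻¹).congr fun n => ?_
      field_simp
      ring
  -- `|g_n g_{n+1}| ≤ g_n² + g_{n+1}²` dominates the mixed series
  have sB : Summable fun n => b n * r ^ n := by
    refine Summable.of_norm_bounded (sE.norm.add sA1.norm) fun n => ?_
    rw [norm_mul (b n), norm_mul (_ * _) (r ^ n), norm_mul (mehlerCoeff _ _ _) (r ^ n), ← add_mul]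
    refine mul_le_mul_of_nonneg_right ?_ (norm_nonneg _)
    rw [Real.norm_of_nonneg (mul_nonneg (by positivity) (mehlerCoeff_nonneg _ _ _)),
      Real.norm_of_nonneg (mehlerCoeff_nonneg _ _ _), ha, ha, Real.norm_eq_abs]
    simp only [b]
    rw [hfac, abs_mul, abs_of_nonneg (by positivity : (0 : ℝ) ≤ (n + 1) * n.factorial), abs_mul]
    have h1 : |g n| * |g (n + 1)| ≤ g n ^ 2 + g (n + 1) ^ 2 := by
      nlinarith [sq_nonneg (|g n| - |g (n + 1)|), sq_abs (g n), sq_abs (g (n + 1)),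
        sq_nonneg (g n), sq_nonneg (g (n + 1))]
    calc _ ≤ ((n : ℝ) + 1) * n.factorial * (g n ^ 2 + g (n + 1) ^ 2) := by gcongr
      _ = _ := by ring
  let A := ∑' n, mehlerCoeff σ y n * r ^ n
  let B := ∑' n, b n * r ^ n
  -- this is `r A' + A`
  let T := ∑' n : ℕ, ((n : ℝ) + 1) * mehlerCoeff σ y n * r ^ n
  have hA : HasSum (fun n => mehlerCoeff σ y n * r ^ n) A := sA.hasSum
  have hB : HasSum (fun n => b n * r ^ n) B := sB.hasSum
  have hT : HasSum (fun n : ℕ => ((n : ℝ) + 1) * mehlerCoeff σ y n * r ^ n) T := sE.hasSum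
  have hA' := (hasSum_nat_add_iff' 1).2 hA
  have hB' := (hasSum_nat_add_iff' 1).2 hB
  have hT' := (hasSum_nat_add_iff' 1).2 hT
  simp only [Finset.sum_range_one, pow_zero, mul_one] at hA' hB' hT'
  have ha0 : mehlerCoeff σ y 0 = 1 := by simp [mehlerCoeff]
  have ha1 : mehlerCoeff σ y 1 = y ^ 2 := by simp [mehlerCoeff]
  have hb0 : b 0 = y := by simp [b, hg0, hg1]
  have E1 : (B - y) + σ * r * B = y * (A - 1) := by
    rw [← hb0, ← ha0, hb0]
    refine HasSum.unique (hb0 ▸ hB'.add (hB.mul_left (σ * r))) ((hA'.mul_left y).congr_fun ?_)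
    intro n
    simp only [b, ha]
    rw [hfac (n + 1), hfac n]
    push_cast
    linear_combination ((n + 1) * n.factorial * g (n + 1) * r ^ (n + 1)) * hg n
  let D := y * B - σ * T
  have hD : HasSum (fun n => y * (b n * r ^ n) -
      σ * (((n : ℝ) + 1) * mehlerCoeff σ y n * r ^ n)) D := (hB.mul_left y).sub (hT.mul_left σ)
  -- the derivative `A'`
  let C := ∑' n : ℕ, ((n : ℝ) + 1) * mehlerCoeff σ y (n + 1) * r ^ n
  have sC : Summable fun n : ℕ => ((n : ℝ) + 1) * mehlerCoeff σ y (n + 1) * r ^ n := by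
    by_cases hr : r = 0
    · refine summable_of_ne_finset_zero (s := {0}) fun n hn => ?_
      simp [hr, zero_pow (by simpa using hn : n ≠ 0)]
    · refine ((((summable_nat_add_iff 1).2 sE).sub ((summable_nat_add_iff 1).2 sA)).mul_left
        r⁻¹).congr fun n => ?_
      push_cast
      field_simp
      ring
  have hC : HasSum (fun n : ℕ => ((n : ℝ) + 1) * mehlerCoeff σ y (n + 1) * r ^ n) C := sC.hasSum
  have hC' := (hasSum_nat_add_iff' 1).2 hC
  simp only [Finset.sum_range_one, pow_zero, mul_one] at hC'
  have E2 : C - y ^ 2 = y * (B - y) - σ * r * D := by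
    have h1 := (hB'.mul_left y).sub (hD.mul_left (σ * r))
    rw [hb0] at h1
    have h2 := hC'
    simp only [ha1, Nat.cast_zero, zero_add, one_mul] at h2
    refine HasSum.unique h2 (h1.congr_fun fun n => ?_)
    simp only [b, ha]
    rw [hfac (n + 1), hfac n]
    have h3 := hg n
    push_cast
    linear_combination ((n + 2) * (n + 1) * n.factorial * g (n + 2) * r ^ (n + 1) -
      σ * r ^ (n + 1) * (n + 1) * n.factorial * g n) * h3
  have E3 : T = r * C + A := by
    have h1 := hT'
    simp only [ha0, Nat.cast_zero, zero_add, one_mul] at h1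
    rw [ha0] at hA'
    have h2 : T - 1 = r * C + (A - 1) := by
      refine HasSum.unique h1 (((hC.mul_left r).add hA').congr_fun fun n => ?_)
      push_cast
      ring
    linarith
  change (1 + σ * r) * (1 - (σ * r) ^ 2) * C = _ * A
  simp only [D] at E2
  rw [E3] at E2
  linear_combination (1 + σ * r) * E2 + y * (1 - σ * r) * E1

/-- Mehler's formula on the diagonal: both sides have value `1` at `r = 0` and solve the same linear
differential equation of first order. -/
theorem hasSum_mehlerCoeff {σ r : ℝ} (hσ : 0 < σ) (hr : 0 ≤ r) (hr1 : σ * r < 1) (y : ℝ) :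
    HasSum (fun n => mehlerCoeff σ y n * r ^ n)
      (Real.exp (y ^ 2 * r / (1 + σ * r)) / √(1 - (σ * r) ^ 2)) := by
  let A := fun r => ∑' n, mehlerCoeff σ y n * r ^ n
  -- the square of the ratio of both sides has derivative zero
  let F := fun r => A r ^ 2 * ((1 - (σ * r) ^ 2) * Real.exp (-(2 * (y ^ 2 * r / (1 + σ * r)))))
  let I := Set.Ioo (-(1 / σ)) (1 / σ)
  have hI : ∀ x ∈ I, |σ * x| < 1 := fun x hx => by
    rw [abs_mul, abs_of_pos hσ, mul_comm, ← lt_div_iff₀ hσ]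
    exact abs_lt.2 hx
  have hF : ∀ x ∈ I, HasDerivAt F 0 x := by
    intro x hx
    have hx1 := hI x hx
    have hp : 0 < 1 + σ * x := by linarith [(abs_lt.1 hx1).1]
    have h1 : HasDerivAt (fun x => 1 - (σ * x) ^ 2) (-(2 * (σ * x) * σ)) x := by
      refine ((((hasDerivAt_id' x).const_mul σ).pow 2).const_sub 1).congr_deriv ?_
      simp
    have h2 : HasDerivAt (fun x => -(2 * (y ^ 2 * x / (1 + σ * x))))
        (-(2 * (y ^ 2 / (1 + σ * x) ^ 2))) x := by
      refine ((((hasDerivAt_id' x).const_mul (y ^ 2)).div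
        (((hasDerivAt_id' x).const_mul σ).const_add 1) hp.ne').const_mul 2).neg.congr_deriv ?_
      field_simp
      ring
    refine (((hasDerivAt_tsum_mehlerCoeff hσ hx1 y).pow 2).mul (h1.mul h2.exp)).congr_deriv ?_
    have ode := tsum_mehlerCoeff_ode hσ hx1 y
    simp only [Pi.pow_apply, Pi.mul_apply]
    generalize (∑' n : ℕ, ((n : ℝ) + 1) * mehlerCoeff σ y (n + 1) * x ^ n) = C at *
    generalize (∑' n : ℕ, mehlerCoeff σ y n * x ^ n) = A at *
    generalize Real.exp (-(2 * (y ^ 2 * x / (1 + σ * x)))) = e at *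
    have e1 : (1 - (σ * x) ^ 2) * C = (y ^ 2 * (1 - σ * x) / (1 + σ * x) + σ ^ 2 * x) * A := by
      field_simp
      linear_combination ode
    have e2 : (1 - (σ * x) ^ 2) * (y ^ 2 / (1 + σ * x) ^ 2) =
        y ^ 2 * (1 - σ * x) / (1 + σ * x) := by
      field_simp
      ring
    push_cast
    linear_combination 2 * A * e * e1 - 2 * A ^ 2 * e * e2
  have hσ' : 0 < 1 / σ := by positivity
  have h0 : (0 : ℝ) ∈ I := ⟨by linarith, hσ'⟩
  have hrI : r ∈ I := ⟨by linarith, by rw [lt_div_iff₀ hσ]; linarith⟩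
  have hconst : F r = F 0 := isOpen_Ioo.is_const_of_deriv_eq_zero isPreconnected_Ioo
    (fun x hx => (hF x hx).differentiableAt.differentiableWithinAt)
    (fun x hx => (hF x hx).deriv) hrI h0
  have hA0 : A 0 = 1 := by
    simp only [A]
    rw [tsum_eq_single 0 fun n hn => by simp [zero_pow hn]]
    simp [mehlerCoeff]
  have hpos : 0 < 1 - (σ * r) ^ 2 := by
    have : 0 ≤ σ * r := by positivity
    nlinarith
  have hsq : A r ^ 2 = (Real.exp (y ^ 2 * r / (1 + σ * r)) / √(1 - (σ * r) ^ 2)) ^ 2 := by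
    simp only [F, hA0] at hconst
    rw [div_pow, Real.sq_sqrt hpos.le, ← Real.exp_nat_mul, eq_div_iff hpos.ne']
    rw [Real.exp_neg, ← mul_assoc] at hconst
    push_cast
    rw [mul_inv_eq_iff_eq_mul₀ (Real.exp_pos _).ne'] at hconst
    rw [hconst]
    simp
  have hAnn : 0 ≤ A r := tsum_nonneg fun n =>
    mul_nonneg (mehlerCoeff_nonneg _ _ _) (pow_nonneg hr n)
  rw [← (sq_eq_sq₀ hAnn (by positivity)).1 hsq]
  exact (summable_mehlerCoeff hσ hr hr1 y).hasSum

/-! ### Sums over injective index tuples -/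

/-- The multi-index with value `1` on `A` and `0` elsewhere. -/
noncomputable def oneOn {ι : Type*} (A : Finset ι) : ι →₀ ℕ := Finsupp.indicator A fun _ _ => 1

theorem oneOn_apply {ι : Type*} [DecidableEq ι] (A : Finset ι) (i : ι) :
    oneOn A i = if i ∈ A then 1 else 0 := by
  rw [oneOn, Finsupp.indicator_apply]
  split_ifs <;> rfl

theorem oneOn_injective {ι : Type*} : Function.Injective (oneOn : Finset ι → ι →₀ ℕ) := by
  classical
  intro A B h
  ext i
  have := DFunLike.congr_fun h i
  rw [oneOn_apply, oneOn_apply] at this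
  by_cases h1 : i ∈ A <;> by_cases h2 : i ∈ B <;> simp_all

theorem prod_oneOn {ι : Type*} [Fintype ι] [DecidableEq ι] {M : Type*} [CommMonoid M]
    (A : Finset ι) (F : ι → ℕ → M)
    (h0 : ∀ i, F i 0 = 1) : ∏ i, F i (oneOn A i) = ∏ i ∈ A, F i 1 := by
  rw [← Finset.prod_subset (Finset.subset_univ A) fun i _ hi => by
    rw [oneOn_apply, if_neg hi, h0]]
  exact Finset.prod_congr rfl fun i hi => by rw [oneOn_apply, if_pos hi]

theorem image_oneOn_subset {ι : Type*} [Fintype ι] [DecidableEq ι] (k : ℕ) :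
    (Finset.powersetCard k (Finset.univ : Finset ι)).image oneOn ⊆
      Finset.univ.finsuppAntidiag k := by
  intro β hβ
  obtain ⟨A, hA, rfl⟩ := Finset.mem_image.1 hβ
  rw [Finset.mem_finsuppAntidiag]
  refine ⟨?_, Finset.subset_univ _⟩
  simp only [oneOn_apply]
  simpa using (Finset.mem_powersetCard.1 hA).2

/-- A set of `k` elements is the image of `k!` injective tuples. -/
theorem card_injective_image_eq {ι : Type*} [Fintype ι] [DecidableEq ι] (k : ℕ)
    (A : Finset ι) (hA : A.card = k) :
    (Finset.univ.filter fun m : Fin k → ι =>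
      Function.Injective m ∧ Finset.univ.image m = A).card = k.factorial := by
  have e : (Fin k ≃ A) ≃ {m : Fin k → ι // Function.Injective m ∧ Finset.univ.image m = A} :=
    { toFun := fun e => ⟨fun l => e l, fun l l' h => e.injective (Subtype.ext h), by
        ext i
        simp only [Finset.mem_image, Finset.mem_univ, true_and]
        exact ⟨fun ⟨l, hl⟩ => hl ▸ (e l).2, fun hi => ⟨e.symm ⟨i, hi⟩, by simp⟩⟩⟩
      invFun := fun m => Equiv.ofBijective
        (fun l => (⟨m.1 l, m.2.2.subset (Finset.mem_image_of_mem _ (Finset.mem_univ l))⟩ : A))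
        ⟨fun l l' h => m.2.1 (congrArg Subtype.val h), fun i => by
          obtain ⟨l, _, hl⟩ := Finset.mem_image.1 (m.2.2.symm.subset i.2)
          exact ⟨l, Subtype.ext hl⟩⟩
      left_inv := fun e => by ext; simp
      right_inv := fun m => Subtype.ext (funext fun l => rfl) }
  rw [← Fintype.card_subtype, ← Fintype.card_congr e,
    Fintype.card_equiv (Fintype.equivOfCardEq (by simp [hA])), Fintype.card_fin]

theorem sum_injective_image {ι : Type*} [Fintype ι] [DecidableEq ι] {M : Type*} [AddCommGroup M]
    [Module ℝ M] (k : ℕ) (F : Finset ι → M) :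
    ∑ m : Fin k → ι with Function.Injective m, F (Finset.univ.image m) =
      (k.factorial : ℝ) • ∑ A ∈ Finset.powersetCard k Finset.univ, F A := by
  rw [← Finset.sum_fiberwise_of_maps_to (t := Finset.powersetCard k Finset.univ)
    (g := fun m : Fin k → ι => Finset.univ.image m), Finset.smul_sum]
  · refine Finset.sum_congr rfl fun A hA => ?_
    rw [Finset.filter_filter, Finset.sum_congr rfl (g := fun _ => F A) fun m hm => by
      rw [(Finset.mem_filter.1 hm).2.2], Finset.sum_const,
      card_injective_image_eq k A (Finset.mem_powersetCard.1 hA).2, Nat.cast_smul_eq_nsmul]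
  · intro m hm
    rw [Finset.mem_powersetCard]
    refine ⟨Finset.subset_univ _, ?_⟩
    rw [Finset.card_image_of_injective _ (Finset.mem_filter.1 hm).2]
    simp

/-! ### Hermite polynomials of independent Gaussian variables -/

section GaussianFamily

variable {ι Ω : Type*} [Fintype ι] [MeasurableSpace Ω] {P : Measure Ω} {v : ℝ≥0} {ξ : Ω → ι → ℝ}

theorem integral_prod_comp (hξ : HasLaw ξ (Measure.pi fun _ => gaussianReal 0 v) P)
    {φ : ι → ℝ → ℝ} (hφ : ∀ i, Continuous (φ i)) :
    ∫ ω, ∏ i, φ i (ξ ω i) ∂P = ∏ i, ∫ x, φ i x ∂gaussianReal 0 v := by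
  have hc : Continuous fun x : ι → ℝ => ∏ i, φ i (x i) := by fun_prop
  rw [← integral_fintype_prod_eq_prod, ← hξ.integral_comp hc.aestronglyMeasurable]
  rfl

theorem memLp_prod_comp (hξ : HasLaw ξ (Measure.pi fun _ => gaussianReal 0 v) P)
    {φ : ι → ℝ → ℝ} (hφ : ∀ i, Continuous (φ i)) (hφ2 : ∀ i, MemLp (φ i) 2 (gaussianReal 0 v)) :
    MemLp (fun ω => ∏ i, φ i (ξ ω i)) 2 P := by
  have hc : Continuous fun x : ι → ℝ => ∏ i, φ i (x i) := by fun_prop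
  have h : MemLp (fun x : ι → ℝ => ∏ i, φ i (x i)) 2 (Measure.pi fun _ => gaussianReal 0 v) := by
    rw [memLp_two_iff_integrable_sq hc.aestronglyMeasurable]
    simp only [← Finset.prod_pow]
    exact Integrable.fintype_prod fun i => (hφ2 i).integrable_sq
  rw [← hξ.map_eq] at h
  exact h.comp_of_map hξ.aemeasurable

/-- The product `∏ i, g_{β i}(ξ i)` of divided Hermite polynomials, for a family `ξ` of independent
centred Gaussian variables of variance `v`. -/
noncomputable def hermiteRV (hξ : HasLaw ξ (Measure.pi fun _ => gaussianReal 0 v) P)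
    (β : ι →₀ ℕ) : Lp ℝ 2 P :=
  (memLp_prod_comp hξ (fun i => continuous_divHermite_right v (β i))
    fun i => memLp_two_divHermite v v (β i)).toLp _

variable (hξ : HasLaw ξ (Measure.pi fun _ => gaussianReal 0 v) P)

theorem coeFn_hermiteRV (β : ι →₀ ℕ) :
    hermiteRV hξ β =ᵐ[P] fun ω => ∏ i, divHermite v (β i) (ξ ω i) :=
  MemLp.coeFn_toLp _

theorem inner_toLp_hermiteRV {φ : ι → ℝ → ℝ} (hφ : ∀ i, Continuous (φ i))
    (h2 : MemLp (fun ω => ∏ i, φ i (ξ ω i)) 2 P) (β : ι →₀ ℕ) :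
    inner ℝ (h2.toLp _) (hermiteRV hξ β) =
      ∏ i, ∫ x, divHermite v (β i) x * φ i x ∂gaussianReal 0 v := by
  rw [hermiteRV, inner_toLp, ← integral_prod_comp hξ (φ := fun i x => divHermite v (β i) x * φ i x)
    fun i => (continuous_divHermite_right v (β i)).mul (hφ i)]
  refine integral_congr_ae (Eventually.of_forall fun ω => ?_)
  simp only
  rw [Finset.prod_mul_distrib, mul_comm]

theorem inner_hermiteRV (hv : v ≠ 0) (β β' : ι →₀ ℕ) [Decidable (β = β')] :
    inner ℝ (hermiteRV hξ β) (hermiteRV hξ β') =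
      if β = β' then ∏ i, (v : ℝ) ^ β i / ((β i).factorial : ℝ) else 0 := by
  rw [hermiteRV, inner_toLp_hermiteRV hξ fun i => continuous_divHermite_right v (β i)]
  simp only [integral_divHermite_mul_divHermite hv]
  split_ifs with h
  · subst h
    simp
  · obtain ⟨i, hi⟩ : ∃ i, β i ≠ β' i := by
      by_contra! h'
      exact h (Finsupp.ext h')
    exact Finset.prod_eq_zero (Finset.mem_univ i) (if_neg hi.symm)

theorem norm_hermiteRV_sq (hv : v ≠ 0) (β : ι →₀ ℕ) :
    ‖hermiteRV hξ β‖ ^ 2 = ∏ i, (v : ℝ) ^ β i / ((β i).factorial : ℝ) := by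
  classical
  rw [← real_inner_self_eq_norm_sq, inner_hermiteRV hξ hv, if_pos rfl]

theorem norm_sum_smul_hermiteRV_sq (hv : v ≠ 0) (c : (ι →₀ ℕ) → ℝ) (S : Finset (ι →₀ ℕ)) :
    ‖∑ β ∈ S, c β • hermiteRV hξ β‖ ^ 2 =
      ∑ β ∈ S, c β ^ 2 * ∏ i, (v : ℝ) ^ β i / ((β i).factorial : ℝ) := by
  classical
  rw [norm_sum_sq_of_orthogonal (X := fun β => c β • hermiteRV hξ β)]
  · simp [norm_smul, mul_pow, norm_hermiteRV_sq hξ hv]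
  · intro i j hij
    simp [inner_smul_left, inner_smul_right, inner_hermiteRV hξ hv, hij]

/-- The homogeneous term of degree `k` of `exp (∑ a_i ξ_i - v ∑ a_i² / 2)` in `a`. -/
noncomputable def expTerm [DecidableEq ι]
    (hξ : HasLaw ξ (Measure.pi fun _ => gaussianReal 0 v) P) (a : ι → ℝ) (k : ℕ) : Lp ℝ 2 P :=
  ∑ β ∈ Finset.univ.finsuppAntidiag k, (∏ i, a i ^ β i) • hermiteRV hξ β

theorem coeFn_sum_smul {α κ : Type*} [MeasurableSpace α] {μ : Measure α} (S : Finset κ)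
    (c : κ → ℝ) (X : κ → Lp ℝ 2 μ) :
    (∑ i ∈ S, c i • X i : Lp ℝ 2 μ) =ᵐ[μ] fun x => ∑ i ∈ S, c i * X i x := by
  classical
  induction S using Finset.induction_on with
  | empty => exact Lp.coeFn_zero ℝ 2 μ
  | insert i S hi ih =>
    rw [Finset.sum_insert hi]
    filter_upwards [Lp.coeFn_add (c i • X i) (∑ i ∈ S, c i • X i), Lp.coeFn_smul (c i) (X i), ih]
      with x h1 h2 h3
    rw [h1, Pi.add_apply, h2, h3, Finset.sum_insert hi, Pi.smul_apply, smul_eq_mul]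

theorem coeFn_expTerm [DecidableEq ι] (a : ι → ℝ) (k : ℕ) :
    expTerm hξ a k =ᵐ[P] fun ω => divHermite (v * ∑ i, a i ^ 2) k (∑ i, a i * ξ ω i) := by
  have h : ∀ᵐ ω ∂P, ∀ β ∈ (Finset.univ : Finset ι).finsuppAntidiag k,
      hermiteRV hξ β ω = ∏ i, divHermite v (β i) (ξ ω i) :=
    (Filter.eventually_all_finset _).2 fun β _ => coeFn_hermiteRV hξ β
  filter_upwards [coeFn_sum_smul (Finset.univ.finsuppAntidiag k) (fun β => ∏ i, a i ^ β i)
    (hermiteRV hξ), h] with ω h1 h2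
  rw [divHermite_linear, expTerm, h1]
  exact Finset.sum_congr rfl fun β hβ => by rw [h2 β hβ]

/-- The off-diagonal part of the `k`-th term of the exponential, that is, its part which is linear
in each of the variables, misses only the non-injective index tuples. -/
theorem norm_expTerm_sub_sq [DecidableEq ι] (hv : v ≠ 0) (a : ι → ℝ) (k : ℕ) :
    ‖(k.factorial : ℝ) • expTerm hξ a k - ∑ m : Fin k → ι with Function.Injective m,
      (∏ l, a (m l)) • hermiteRV hξ (oneOn (Finset.univ.image m))‖ ^ 2 =
      (k.factorial : ℝ) * ((v : ℝ) ^ k *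
        ∑ m : Fin k → ι with ¬ Function.Injective m, ∏ l, a (m l) ^ 2) := by
  -- the off-diagonal sum collects the squarefree multi-indices, each of them `k!` times
  have hprod : ∀ (y : ι → ℝ) (m : Fin k → ι), Function.Injective m →
      ∏ l, y (m l) = ∏ i ∈ Finset.univ.image m, y i := fun y m hm =>
    (Finset.prod_image fun _ _ _ _ h => hm h).symm
  have h1 : ∑ m : Fin k → ι with Function.Injective m,
      (∏ l, a (m l)) • hermiteRV hξ (oneOn (Finset.univ.image m)) = (k.factorial : ℝ) •
        ∑ β ∈ (Finset.powersetCard k (Finset.univ : Finset ι)).image oneOn,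
          (∏ i, a i ^ β i) • hermiteRV hξ β := by
    rw [Finset.sum_image fun _ _ _ _ h => oneOn_injective h,
      ← sum_injective_image k fun A => (∏ i, a i ^ oneOn A i) • hermiteRV hξ (oneOn A)]
    refine Finset.sum_congr rfl fun m hm => ?_
    rw [prod_oneOn _ (fun i n => a i ^ n) (fun i => pow_zero _),
      hprod a m (Finset.mem_filter.1 hm).2]
    simp
  have h2 : (v : ℝ) ^ k * ∑ m : Fin k → ι with Function.Injective m, ∏ l, a (m l) ^ 2 =
      (k.factorial : ℝ) * ∑ β ∈ (Finset.powersetCard k (Finset.univ : Finset ι)).image oneOn,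
        (∏ i, a i ^ β i) ^ 2 * ∏ i, (v : ℝ) ^ β i / ((β i).factorial : ℝ) := by
    rw [Finset.sum_image fun _ _ _ _ h => oneOn_injective h, ← smul_eq_mul (k.factorial : ℝ),
      ← sum_injective_image k fun A => (∏ i, a i ^ oneOn A i) ^ 2 *
        ∏ i, (v : ℝ) ^ oneOn A i / ((oneOn A i).factorial : ℝ), Finset.mul_sum]
    refine Finset.sum_congr rfl fun m hm => ?_
    have hm' := (Finset.mem_filter.1 hm).2
    rw [prod_oneOn _ (fun i n => a i ^ n) (fun i => pow_zero _),
      prod_oneOn _ (fun i n => (v : ℝ) ^ n / (n.factorial : ℝ)) (fun i => by simp),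
      ← hprod (fun i => a i ^ 1) m hm', Finset.prod_pow, Finset.prod_const,
      Finset.card_image_of_injective _ hm']
    simp [mul_comm]
  -- the squared norm of the whole term, by the multinomial theorem
  have h3 : ∑ β ∈ (Finset.univ : Finset ι).finsuppAntidiag k,
      (∏ i, a i ^ β i) ^ 2 * ∏ i, (v : ℝ) ^ β i / ((β i).factorial : ℝ) =
        (v : ℝ) ^ k * (∑ m : Fin k → ι, ∏ l, a (m l) ^ 2) / (k.factorial : ℝ) := by
    rw [← Fintype.sum_pow (fun i => a i ^ 2), ← mul_pow, Finset.mul_sum,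
      ← sum_finsuppAntidiag_prod_pow_div_factorial]
    refine Finset.sum_congr rfl fun β _ => ?_
    rw [← Finset.prod_pow, ← Finset.prod_mul_distrib]
    refine Finset.prod_congr rfl fun i _ => ?_
    rw [mul_pow]
    ring
  have hsplit := Finset.sum_filter_add_sum_filter_not Finset.univ
    (fun m : Fin k → ι => Function.Injective m) (fun m => ∏ l, a (m l) ^ 2)
  have hk : (k.factorial : ℝ) ≠ 0 := by positivity
  rw [h1, expTerm, ← smul_sub, ← Finset.sum_sdiff (image_oneOn_subset (ι := ι) k),
    add_sub_cancel_right, norm_smul, mul_pow, norm_sum_smul_hermiteRV_sq hξ hv,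
    Finset.sum_sdiff_eq_sub (image_oneOn_subset (ι := ι) k), h3, Real.norm_eq_abs, sq_abs,
    ← hsplit]
  field_simp
  linear_combination h2

end GaussianFamily

/-! ### Subdivisions of a time interval -/

section Mesh

/-- The `n`-th point of the subdivision of `[s, t]` into `N + 1` intervals of equal length. The
projection to `[0, 1]` matters only for `n > N + 1`. -/
noncomputable def mesh (s t : unitInterval) (N n : ℕ) : unitInterval :=
  Set.projIcc 0 1 zero_le_one ((s : ℝ) + n / (N + 1) * ((t : ℝ) - s))

variable {s t : unitInterval}

theorem monotone_mesh (hst : s ≤ t) (N : ℕ) : Monotone (mesh s t N) := by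
  intro n m h
  have h1 : (0 : ℝ) ≤ (t : ℝ) - s := sub_nonneg.2 hst
  refine Set.monotone_projIcc _ ?_
  gcongr

theorem coe_mesh (hst : s ≤ t) {N n : ℕ} (hn : n ≤ N + 1) :
    (mesh s t N n : ℝ) = (s : ℝ) + n / (N + 1) * ((t : ℝ) - s) := by
  have h1 : (0 : ℝ) ≤ (t : ℝ) - s := sub_nonneg.2 hst
  have h2 : (n : ℝ) / (N + 1) ≤ 1 := by
    rw [div_le_one (by positivity)]
    exact_mod_cast hn
  have h3 : (0 : ℝ) ≤ (n : ℝ) / (N + 1) := by positivity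
  rw [mesh, Set.projIcc_of_mem zero_le_one]
  refine ⟨add_nonneg s.2.1 (mul_nonneg h3 h1), ?_⟩
  nlinarith [t.2.2]

theorem mesh_zero (hst : s ≤ t) (N : ℕ) : mesh s t N 0 = s := by
  ext
  rw [coe_mesh hst (Nat.zero_le _)]
  simp

theorem mesh_last (hst : s ≤ t) (N : ℕ) : mesh s t N (N + 1) = t := by
  ext
  rw [coe_mesh hst le_rfl]
  have : (N + 1 : ℝ) ≠ 0 := by positivity
  push_cast
  field_simp
  ring

theorem mesh_succ_sub (hst : s ≤ t) {N n : ℕ} (hn : n < N + 1) :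
    (mesh s t N (n + 1) : ℝ) - mesh s t N n = ((t : ℝ) - s) / (N + 1) := by
  rw [coe_mesh hst hn, coe_mesh hst hn.le]
  push_cast
  field_simp
  ring

/-- The cell of the subdivision, in time and component, with index `p`. -/
def cell {d : ℕ} (s t : unitInterval) (N : ℕ) (p : Fin (N + 1) × Fin d) :
    Set (unitInterval × Fin d) :=
  Set.Ioc (mesh s t N p.1) (mesh s t N (p.1 + 1)) ×ˢ {p.2}

variable {d k : ℕ}

theorem disjoint_cell (hst : s ≤ t) {N : ℕ} {p q : Fin (N + 1) × Fin d} (h : p ≠ q) :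
    Disjoint (cell s t N p) (cell s t N q) := by
  rw [cell, cell, Set.disjoint_prod]
  by_cases h2 : p.2 = q.2
  · left
    refine (monotone_mesh hst N).pairwise_disjoint_on_Ioc_succ fun h1 => h ?_
    exact Prod.ext (Fin.ext h1) h2
  · right
    simpa using h2

theorem measurableSet_cell (N : ℕ) (p : Fin (N + 1) × Fin d) : MeasurableSet (cell s t N p) :=
  measurableSet_Ioc.prod (measurableSet_singleton _)

theorem sum_indicator_cell (hst : s ≤ t) (N : ℕ) (a : Fin d → ℝ) (x : unitInterval × Fin d) :
    ∑ p : Fin (N + 1) × Fin d, a p.2 * (cell s t N p).indicator 1 x =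
      a x.2 * (Set.Ioc s t).indicator 1 x.1 := by
  have h1 : ∀ u v : unitInterval, u ≤ v → (Set.Ioc u v).indicator (1 : unitInterval → ℝ) x.1 =
      (if x.1 ≤ v then 1 else 0) - if x.1 ≤ u then 1 else 0 := by
    intro u v huv
    by_cases hu : x.1 ≤ u
    · simp [hu, hu.trans huv, not_lt.2 hu]
    · by_cases hv : x.1 ≤ v
      · simp [hu, hv, lt_of_not_ge hu]
      · simp [hu, hv]
  have h2 : ∀ n c, a c * (cell s t N (n, c)).indicator (1 : unitInterval × Fin d → ℝ) x =
      (Set.Ioc (mesh s t N n) (mesh s t N (n + 1))).indicator 1 x.1 *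
        if x.2 = c then a c else 0 := by
    intro n c
    by_cases hc : x.2 = c
    · by_cases hx : x.1 ∈ Set.Ioc (mesh s t N n) (mesh s t N (n + 1))
      · rw [Set.indicator_of_mem (by exact ⟨hx, hc⟩), Set.indicator_of_mem hx, if_pos hc]
        simp
      · rw [Set.indicator_of_notMem (fun h => hx h.1), Set.indicator_of_notMem hx]
        simp
    · rw [Set.indicator_of_notMem (fun h => hc h.2), if_neg hc]
      simp
  rw [Fintype.sum_prod_type]
  simp only [h2]
  simp only [← Finset.mul_sum, Finset.sum_ite_eq, Finset.mem_univ, if_true, ← Finset.sum_mul]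
  rw [mul_comm]
  congr 1
  rw [h1 s t hst, Finset.sum_congr rfl fun (n : Fin (N + 1)) _ =>
    h1 _ _ (monotone_mesh hst N (Nat.le_add_right (n : ℕ) 1)),
    Fin.sum_univ_eq_sum_range (fun n => (if x.1 ≤ mesh s t N (n + 1) then (1 : ℝ) else 0) -
      if x.1 ≤ mesh s t N n then 1 else 0) (N + 1), Finset.sum_range_sub fun n =>
      if x.1 ≤ mesh s t N n then (1 : ℝ) else 0, mesh_last hst, mesh_zero hst]

theorem prod_indicator_one {α : Type*} {κ : Type*} [Fintype κ] (A : κ → Set α) (x : κ → α) :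
    ∏ l, (A l).indicator (1 : α → ℝ) (x l) =
      (Set.univ.pi A).indicator (1 : (κ → α) → ℝ) x := by
  by_cases h : x ∈ Set.univ.pi A
  · rw [Set.indicator_of_mem h]
    exact Finset.prod_eq_one fun l _ => Set.indicator_of_mem (h l (Set.mem_univ l)) _
  · rw [Set.indicator_of_notMem h]
    simp only [Set.mem_univ_pi, not_forall] at h
    obtain ⟨l, hl⟩ := h
    exact Finset.prod_eq_zero (Finset.mem_univ l) (Set.indicator_of_notMem hl _)

instance isFiniteMeasure_kernelMeasure (d k : ℕ) : IsFiniteMeasure (kernelMeasure d k) := by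
  unfold kernelMeasure
  infer_instance

/-- The product of the cells with indices `m`. -/
def box (s t : unitInterval) (N : ℕ) (m : Fin k → Fin (N + 1) × Fin d) :
    Set (Fin k → unitInterval × Fin d) :=
  Set.univ.pi fun l => cell s t N (m l)

theorem measurableSet_box (N : ℕ) (m : Fin k → Fin (N + 1) × Fin d) :
    MeasurableSet (box s t N m) :=
  MeasurableSet.univ_pi fun l => measurableSet_cell N (m l)

theorem measureReal_box (hst : s ≤ t) (N : ℕ) (m : Fin k → Fin (N + 1) × Fin d) :
    (kernelMeasure d k).real (box s t N m) = (((t : ℝ) - s) / (N + 1)) ^ k := by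
  have h1 : (0 : ℝ) ≤ ((t : ℝ) - s) / (N + 1) :=
    div_nonneg (sub_nonneg.2 hst) (by positivity)
  have h : ∀ l, ((volume : Measure unitInterval).prod Measure.count) (cell s t N (m l)) =
      ENNReal.ofReal (((t : ℝ) - s) / (N + 1)) := by
    intro l
    rw [cell, Measure.prod_prod, unitInterval.volume_Ioc, mesh_succ_sub hst (m l).1.2,
      Measure.count_singleton, mul_one]
  rw [measureReal_def, kernelMeasure, box, Measure.pi_pi, Finset.prod_congr rfl fun l _ => h l,
    Finset.prod_const, ENNReal.toReal_pow, ENNReal.toReal_ofReal h1]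
  simp

/-- The indicator function of a box, as a kernel. -/
noncomputable def boxKernel (s t : unitInterval) (N : ℕ) (m : Fin k → Fin (N + 1) × Fin d) :
    Kernel2 d k :=
  indicatorConstLp 2 (measurableSet_box N m) (measure_ne_top (kernelMeasure d k) (box s t N m)) 1

theorem coeFn_boxKernel (N : ℕ) (m : Fin k → Fin (N + 1) × Fin d) :
    boxKernel s t N m =ᵐ[kernelMeasure d k] (box s t N m).indicator 1 :=
  indicatorConstLp_coeFn

theorem inner_boxKernel (hst : s ≤ t) (N : ℕ) {m m' : Fin k → Fin (N + 1) × Fin d} (h : m ≠ m') :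
    inner ℝ (boxKernel s t N m) (boxKernel s t N m') = 0 := by
  rw [boxKernel, boxKernel, L2.real_inner_indicatorConstLp_one_indicatorConstLp_one]
  obtain ⟨l, hl⟩ := Function.ne_iff.1 h
  have : box s t N m ∩ box s t N m' = ∅ := by
    rw [← Set.disjoint_iff_inter_eq_empty, Set.disjoint_left]
    exact fun x h1 h2 => Set.disjoint_left.1 (disjoint_cell hst hl) (h1 l (Set.mem_univ l))
      (h2 l (Set.mem_univ l))
  simp [this]

theorem norm_boxKernel_sq (hst : s ≤ t) (N : ℕ) (m : Fin k → Fin (N + 1) × Fin d) :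
    ‖boxKernel s t N m‖ ^ 2 = (((t : ℝ) - s) / (N + 1)) ^ k := by
  rw [← real_inner_self_eq_norm_sq, boxKernel,
    L2.real_inner_indicatorConstLp_one_indicatorConstLp_one, Set.inter_self, measureReal_box hst]

/-- The kernel `∏ l, a_{j_l} 1_{(s,t]}(t_l)`, decomposed along the trivial subdivision. -/
noncomputable def powerKernel (s t : unitInterval) (a : Fin d → ℝ) (k : ℕ) : Kernel2 d k :=
  ∑ m : Fin k → Fin (0 + 1) × Fin d, (∏ l, a (m l).2) • boxKernel s t 0 m

/-- Along every subdivision the boxes add up to the full kernel. -/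
theorem coeFn_sum_boxKernel (hst : s ≤ t) (N : ℕ) (a : Fin d → ℝ) :
    (∑ m : Fin k → Fin (N + 1) × Fin d, (∏ l, a (m l).2) • boxKernel s t N m : Kernel2 d k)
      =ᵐ[kernelMeasure d k] fun x => ∏ l, (a (x l).2 * (Set.Ioc s t).indicator 1 (x l).1) := by
  have h : ∀ᵐ x ∂kernelMeasure d k, ∀ m : Fin k → Fin (N + 1) × Fin d,
      boxKernel s t N m x = (box s t N m).indicator 1 x :=
    ae_all_iff.2 fun m => coeFn_boxKernel N m
  filter_upwards [coeFn_sum_smul Finset.univ (fun m : Fin k → Fin (N + 1) × Fin d =>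
    ∏ l, a (m l).2) (boxKernel s t N), h] with x h1 h2
  rw [h1]
  simp only [← sum_indicator_cell hst N, h2, box]
  rw [Finset.prod_univ_sum, Fintype.piFinset_univ]
  refine Finset.sum_congr rfl fun m _ => ?_
  rw [Finset.prod_mul_distrib, prod_indicator_one]

theorem sum_boxKernel (hst : s ≤ t) (N : ℕ) (a : Fin d → ℝ) :
    ∑ m : Fin k → Fin (N + 1) × Fin d, (∏ l, a (m l).2) • boxKernel s t N m =
      powerKernel s t a k :=
  Lp.ext ((coeFn_sum_boxKernel hst N a).trans (coeFn_sum_boxKernel hst 0 a).symm)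

theorem isSymmKernel_powerKernel (hst : s ≤ t) (a : Fin d → ℝ) :
    IsSymmKernel (powerKernel s t a k) :=
  ⟨_, fun π x => Equiv.prod_comp π fun l => a (x l).2 * (Set.Ioc s t).indicator 1 (x l).1,
    coeFn_sum_boxKernel hst 0 a⟩

/-- The off-diagonal part of the kernel misses only the boxes with non-injective index tuples. -/
theorem norm_powerKernel_sub_sq (hst : s ≤ t) (N : ℕ) (a : Fin d → ℝ) :
    ‖powerKernel s t a k - ∑ m : Fin k → Fin (N + 1) × Fin d with Function.Injective m,
      (∏ l, a (m l).2) • boxKernel s t N m‖ ^ 2 = (((t : ℝ) - s) / (N + 1)) ^ k *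
        ∑ m : Fin k → Fin (N + 1) × Fin d with ¬ Function.Injective m, ∏ l, a (m l).2 ^ 2 := by
  rw [← sum_boxKernel hst N, ← Finset.sum_filter_add_sum_filter_not Finset.univ
    (fun m : Fin k → Fin (N + 1) × Fin d => Function.Injective m), add_sub_cancel_left,
    norm_sum_sq_of_orthogonal (X := fun m : Fin k → Fin (N + 1) × Fin d =>
      (∏ l, a (m l).2) • boxKernel s t N m), Finset.mul_sum]
  · refine Finset.sum_congr rfl fun m _ => ?_
    rw [norm_smul, mul_pow, norm_boxKernel_sq hst, Finset.prod_pow, Real.norm_eq_abs, sq_abs,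
      mul_comm]
  · intro m m' h
    simp [inner_smul_left, inner_smul_right, inner_boxKernel hst N h]

end Mesh

/-! ### The diagonal is negligible -/

/-- At most the fraction `k² / M` of the `M ^ k` index tuples is not injective. -/
theorem pow_sub_descFactorial_mul_le (M k : ℕ) :
    ((M : ℝ) ^ k - M.descFactorial k) * M ≤ (k : ℝ) ^ 2 * (M : ℝ) ^ k := by
  induction k with
  | zero => simp
  | succ k ih =>
    have h1 : (M : ℝ) - k ≤ ((M - k : ℕ) : ℝ) := by
      rw [sub_le_iff_le_add]
      have : M ≤ M - k + k := by omega
      exact_mod_cast this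
    have h2 : (M.descFactorial k : ℝ) ≤ (M : ℝ) ^ k := by
      exact_mod_cast Nat.descFactorial_le_pow M k
    have h3 : ((M : ℝ) - k) * M.descFactorial k ≤ (M.descFactorial (k + 1) : ℝ) := by
      rw [Nat.descFactorial_succ]
      push_cast
      exact mul_le_mul_of_nonneg_right h1 (Nat.cast_nonneg _)
    have hM : (0 : ℝ) ≤ M := Nat.cast_nonneg M
    have hk : (0 : ℝ) ≤ k := Nat.cast_nonneg k
    have h4 : (k : ℝ) * M.descFactorial k ≤ k * (M : ℝ) ^ k := mul_le_mul_of_nonneg_left h2 hk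
    have h5 := mul_le_mul_of_nonneg_right ih hM
    have h6 : (M : ℝ) ^ (k + 1) - M.descFactorial (k + 1) ≤
        ((M : ℝ) ^ k - M.descFactorial k) * M + k * (M : ℝ) ^ k := by
      rw [pow_succ]
      nlinarith
    have h7 := mul_le_mul_of_nonneg_right h6 hM
    have h8 : 0 ≤ (M : ℝ) ^ k * M := by positivity
    have h9 : 0 ≤ (k : ℝ) * ((M : ℝ) ^ k * M) := by positivity
    push_cast
    rw [pow_succ] at *
    nlinarith

theorem card_not_injective (k : ℕ) (ι : Type*) [Fintype ι] [DecidableEq ι] :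
    ((Finset.univ.filter fun m : Fin k → ι => ¬ Function.Injective m).card : ℝ) =
      (Fintype.card ι : ℝ) ^ k - (Fintype.card ι).descFactorial k := by
  have h := Finset.card_filter_add_card_filter_not (s := (Finset.univ : Finset (Fin k → ι)))
    (fun m => Function.Injective m)
  have h2 : (Finset.univ.filter fun m : Fin k → ι => Function.Injective m).card =
      (Fintype.card ι).descFactorial k := by
    rw [← Fintype.card_subtype,
      Fintype.card_congr (Equiv.subtypeInjectiveEquivEmbedding (Fin k) ι),
      Fintype.card_embedding_eq, Fintype.card_fin]
  rw [h2, Finset.card_univ, Fintype.card_pi_const] at h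
  rw [eq_sub_iff_add_eq, add_comm]
  exact_mod_cast h

/-- The non-injective index tuples carry a vanishing part of the mass as the mesh tends to `0`. -/
theorem tendsto_sum_not_injective {d : ℕ} (hd : 0 < d) (k : ℕ) (a : Fin d → ℝ) {τ : ℝ}
    (hτ : 0 ≤ τ) :
    Tendsto (fun N : ℕ => (τ / (N + 1)) ^ k *
      ∑ m : Fin k → Fin (N + 1) × Fin d with ¬ Function.Injective m, ∏ l, a (m l).2 ^ 2)
      atTop (𝓝 0) := by
  let L := ∑ c, a c ^ 2
  have hL : ∀ c, a c ^ 2 ≤ L := fun c =>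
    Finset.single_le_sum (f := fun c => a c ^ 2) (fun c _ => sq_nonneg _) (Finset.mem_univ c)
  have hL0 : 0 ≤ L := Finset.sum_nonneg fun c _ => sq_nonneg _
  have hlim : Tendsto (fun N : ℕ => τ ^ k * L ^ k * ((k : ℝ) ^ 2 * (d : ℝ) ^ k / d) *
      (1 / ((N : ℝ) + 1))) atTop (𝓝 0) := by
    simpa using tendsto_one_div_add_atTop_nhds_zero_nat.const_mul
      (τ ^ k * L ^ k * ((k : ℝ) ^ 2 * (d : ℝ) ^ k / d))
  refine squeeze_zero (fun N => mul_nonneg (by positivity)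
    (Finset.sum_nonneg fun m _ => Finset.prod_nonneg fun l _ => sq_nonneg _)) (fun N => ?_) hlim
  have hN : (0 : ℝ) < (N : ℝ) + 1 := by positivity
  have hd' : (0 : ℝ) < d := by exact_mod_cast hd
  have hs : ∑ m : Fin k → Fin (N + 1) × Fin d with ¬ Function.Injective m, ∏ l, a (m l).2 ^ 2 ≤
      ((((N : ℝ) + 1) * d) ^ k - ((N + 1) * d).descFactorial k) * L ^ k := by
    refine (Finset.sum_le_card_nsmul _ _ (L ^ k) fun m _ => ?_).trans_eq ?_
    · refine (Finset.prod_le_prod (fun l _ => sq_nonneg _) fun l _ => hL (m l).2).trans_eq ?_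
      simp
    · rw [nsmul_eq_mul, card_not_injective]
      simp
  have hM := pow_sub_descFactorial_mul_le ((N + 1) * d) k
  push_cast at hM
  rw [← le_div_iff₀ (by positivity)] at hM
  calc _ ≤ (τ / (N + 1)) ^ k * (((k : ℝ) ^ 2 * (((N : ℝ) + 1) * d) ^ k / (((N : ℝ) + 1) * d)) *
        L ^ k) := mul_le_mul_of_nonneg_left (hs.trans (mul_le_mul_of_nonneg_right hM
          (by positivity))) (by positivity)
    _ = _ := by
      rw [div_pow, mul_pow]
      field_simp

/-! ### Hermite polynomials of the increments lie in the chaoses -/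

/-- The increments of the components of `w` over the intervals of a subdivision. -/
noncomputable def increments {d : ℕ} {Ω : Type*}
    (w : unitInterval → Ω → EuclideanSpace ℝ (Fin d))
    (s t : unitInterval) (N : ℕ) (ω : Ω) (p : Fin (N + 1) × Fin d) : ℝ :=
  w (mesh s t N (p.1 + 1)) ω p.2 - w (mesh s t N p.1) ω p.2

theorem sum_increments {d : ℕ} {Ω : Type*} {w : unitInterval → Ω → EuclideanSpace ℝ (Fin d)}
    {s t : unitInterval} (hst : s ≤ t) (N : ℕ) (a : Fin d → ℝ) (ω : Ω) :
    ∑ p, a p.2 * increments w s t N ω p = ∑ c, a c * (w t ω c - w s ω c) := by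
  rw [Fintype.sum_prod_type, Finset.sum_comm]
  refine Finset.sum_congr rfl fun c _ => ?_
  simp only [increments]
  rw [← Finset.mul_sum, Fin.sum_univ_eq_sum_range
    (fun n => w (mesh s t N (n + 1)) ω c - w (mesh s t N n) ω c) (N + 1),
    Finset.sum_range_sub fun n => w (mesh s t N n) ω c, mesh_last hst, mesh_zero hst]

section Chaos

variable {d : ℕ} {Ω : Type*} [MeasurableSpace Ω] {P : Measure Ω}
  {w : unitInterval → Ω → EuclideanSpace ℝ (Fin d)} {s t : unitInterval}

/-- The increments over all cells are independent, in time by the independence of increments and in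
the components by the law of a single increment. -/
theorem hasLaw_increments [IsProbabilityMeasure P] (hw : IsBrownianMotion w P) (hst : s ≤ t)
    (N : ℕ) : HasLaw (increments w s t N) (Measure.pi fun _ =>
      gaussianReal 0 (Real.toNNReal (((t : ℝ) - s) / (N + 1)))) P := by
  have hm : ∀ r, Measurable fun ω (c : Fin d) => w r ω c := fun r => by
    have := hw.measurable r
    fun_prop
  have hlaw : ∀ n : Fin (N + 1), HasLaw
      (fun ω (c : Fin d) => w (mesh s t N (n + 1)) ω c - w (mesh s t N n) ω c)
      (Measure.pi fun _ => gaussianReal 0 (Real.toNNReal (((t : ℝ) - s) / (N + 1)))) P :=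
      fun n => by
    have h := hw.law_increments _ _ (monotone_mesh hst N (Nat.le_add_right (n : ℕ) 1))
    rwa [mesh_succ_sub hst n.2] at h
  have hlaw1 : ∀ (n : Fin (N + 1)) (c : Fin d), HasLaw
      (fun ω => w (mesh s t N (n + 1)) ω c - w (mesh s t N n) ω c)
      (gaussianReal 0 (Real.toNNReal (((t : ℝ) - s) / (N + 1)))) P := fun n c =>
    (measurePreserving_eval (fun _ : Fin d => gaussianReal 0 _) c).hasLaw.comp (hlaw n)
  refine iIndepFun.hasLaw_pi (X := fun p ω => increments w s t N ω p)
    (fun p => hlaw1 p.1 p.2) ?_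
  refine iIndepFun_uncurry' (X := fun (n : Fin (N + 1)) (c : Fin d) ω =>
    w (mesh s t N (n + 1)) ω c - w (mesh s t N n) ω c) (fun n c => ?_) ?_ fun n => ?_
  · exact (measurable_pi_iff.1 (hm _) c).sub (measurable_pi_iff.1 (hm _) c)
  · have h := (hw.indep_increments.nat (monotone_mesh hst N)).precomp
      (g := fun n : Fin (N + 1) => (n : ℕ)) Fin.val_injective
    exact h.comp (fun _ x c => x c) fun _ => by fun_prop
  · exact (iIndepFun_iff_hasLaw_pi_pi (hlaw1 n)).2 (hlaw n)

/-- The terms of the exponential of an increment can be computed along any subdivision. -/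
theorem expTerm_increments [IsProbabilityMeasure P] (hw : IsBrownianMotion w P) (hst : s ≤ t)
    (N k : ℕ) (a : Fin d → ℝ) :
    expTerm (hasLaw_increments hw hst N) (fun p => a p.2) k =
      expTerm (hw.law_increments s t hst) a k := by
  refine Lp.ext ((coeFn_expTerm _ _ _).trans (EventuallyEq.trans ?_ (coeFn_expTerm _ _ _).symm))
  refine Eventually.of_forall fun ω => ?_
  have h0 : (0 : ℝ) ≤ (t : ℝ) - s := sub_nonneg.2 hst
  simp only
  rw [sum_increments hst, Real.coe_toNNReal _ h0, Real.coe_toNNReal _ (by positivity),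
    Fintype.sum_prod_type]
  congr 1
  simp only [Finset.sum_const, Finset.card_univ, Fintype.card_fin, nsmul_eq_mul]
  push_cast
  field_simp

/-- For distinct cells the Hermite polynomials have degree `1`, so that `hermiteRV` is the product
of the increments. -/
theorem mem_elementaryIntegrals [IsProbabilityMeasure P] (hw : IsBrownianMotion w P)
    (hst : s ≤ t) {k N : ℕ} {m : Fin k → Fin (N + 1) × Fin d} (hm : Function.Injective m) :
    (boxKernel s t N m, hermiteRV (hasLaw_increments hw hst N) (oneOn (Finset.univ.image m))) ∈
      elementaryIntegrals w P k := by
  refine ⟨fun l => mesh s t N (m l).1, fun l => mesh s t N ((m l).1 + 1), fun l => (m l).2,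
    fun l => monotone_mesh hst N (Nat.le_add_right _ 1),
    fun l l' h => disjoint_cell hst (hm.ne h), coeFn_boxKernel N m, ?_⟩
  refine (coeFn_hermiteRV (hasLaw_increments hw hst N) _).trans (Eventually.of_forall fun ω => ?_)
  simp only
  rw [prod_oneOn _ (fun p n => divHermite _ n (increments w s t N ω p))
    (fun p => divHermite_zero _ _), Finset.prod_image fun _ _ _ _ h => hm h]
  simp [increments]

theorem tendsto_of_norm_sub_sq {E : Type*} [NormedAddCommGroup E] {x : E} {y : ℕ → E}
    (h : Tendsto (fun n => ‖x - y n‖ ^ 2) atTop (𝓝 0)) : Tendsto y atTop (𝓝 x) := by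
  rw [tendsto_iff_norm_sub_tendsto_zero]
  have h2 := (Real.continuous_sqrt.tendsto 0).comp h
  rw [Real.sqrt_zero] at h2
  refine h2.congr fun n => ?_
  rw [Function.comp_apply, Real.sqrt_sq (norm_nonneg _), norm_sub_rev]

/-- The terms of the exponential of an increment are multiple integrals of powers: the off-diagonal
sums along finer and finer subdivisions are elementary integrals, and both their kernels and their
values converge. -/
theorem isMultipleIntegral_expTerm [IsProbabilityMeasure P] (hw : IsBrownianMotion w P)
    (hst : s < t) (hd : 0 < d) (k : ℕ) (a : Fin d → ℝ) :
    IsMultipleIntegral w P k (powerKernel s t a k)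
      ((k.factorial : ℝ) • expTerm (hw.law_increments s t hst.le) a k) := by
  have h0 : (0 : ℝ) < (t : ℝ) - s := sub_pos.2 hst
  have hlim := tendsto_sum_not_injective hd k a h0.le
  let K : ℕ → Kernel2 d k := fun N =>
    ∑ m : Fin k → Fin (N + 1) × Fin d with Function.Injective m,
      (∏ l, a (m l).2) • boxKernel s t N m
  let S : ℕ → Lp ℝ 2 P := fun N =>
    ∑ m : Fin k → Fin (N + 1) × Fin d with Function.Injective m, (∏ l, a (m l).2) •
      hermiteRV (hasLaw_increments hw hst.le N) (oneOn (Finset.univ.image m))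
  have hK : Tendsto K atTop (𝓝 (powerKernel s t a k)) := by
    refine tendsto_of_norm_sub_sq ?_
    simpa only [K, norm_powerKernel_sub_sq hst.le] using hlim
  have hS : Tendsto S atTop (𝓝 ((k.factorial : ℝ) •
      expTerm (hw.law_increments s t hst.le) a k)) := by
    refine tendsto_of_norm_sub_sq ?_
    have h := hlim.const_mul (k.factorial : ℝ)
    rw [mul_zero] at h
    refine h.congr fun N => ?_
    have hb : (0 : ℝ) < ((t : ℝ) - s) / (N + 1) := by positivity
    have := norm_expTerm_sub_sq (hasLaw_increments hw hst.le N)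
      (Real.toNNReal_pos.2 hb).ne' (fun p => a p.2) k
    rw [expTerm_increments hw hst.le, Real.coe_toNNReal _ hb.le] at this
    exact this.symm
  refine mem_closure_of_tendsto (hK.prodMk_nhds hS) (Eventually.of_forall fun N => ?_)
  have h : (K N, S N) = ∑ m : Fin k → Fin (N + 1) × Fin d with Function.Injective m,
      (∏ l, a (m l).2) • ((boxKernel s t N m, hermiteRV (hasLaw_increments hw hst.le N)
        (oneOn (Finset.univ.image m))) : Kernel2 d k × Lp ℝ 2 P) := by
    refine Prod.ext ?_ ?_
    · simp [K, Prod.fst_sum]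
    · simp [S, Prod.snd_sum]
  rw [h]
  exact Submodule.sum_mem _ fun m hm => Submodule.smul_mem _ _ (Submodule.subset_span
    (mem_elementaryIntegrals hw hst.le (Finset.mem_filter.1 hm).2))

theorem expTerm_mem_chaos [IsProbabilityMeasure P] (hw : IsBrownianMotion w P)
    (hst : s < t) (hd : 0 < d) (k : ℕ) (a : Fin d → ℝ) :
    expTerm (hw.law_increments s t hst.le) a k ∈ chaos w P k := by
  have h : (k.factorial : ℝ) • expTerm (hw.law_increments s t hst.le) a k ∈ chaos w P k :=
    ⟨_, isSymmKernel_powerKernel hst.le a, isMultipleIntegral_expTerm hw hst hd k a⟩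
  have := (chaos w P k).smul_mem (k.factorial : ℝ)⁻¹ h
  rwa [smul_smul, inv_mul_cancel₀ (by positivity), one_smul] at this

/-- Polarization: the coefficients of a vector-valued polynomial lie in every subspace which
contains its values. -/
theorem coeff_mem_of_forall_sum_mem {ι V : Type*} [Fintype ι] [AddCommGroup V] [Module ℝ V]
    (U : Submodule ℝ V) (S : Finset (ι →₀ ℕ)) (X : (ι →₀ ℕ) → V)
    (h : ∀ a : ι → ℝ, ∑ β ∈ S, (∏ i, a i ^ β i) • X β ∈ U) {α : ι →₀ ℕ} (hα : α ∈ S) :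
    X α ∈ U := by
  classical
  -- a functional that vanishes on `U` but not at `X α` would give a polynomial with all values zero
  by_contra hX
  obtain ⟨φ, hφ, hU⟩ := Submodule.exists_le_ker_of_notMem hX
  have hp : ∑ β ∈ S, MvPolynomial.monomial β (φ (X β)) = 0 := by
    refine MvPolynomial.funext fun a => ?_
    have h1 := LinearMap.mem_ker.1 (hU (h a))
    rw [map_sum] at h1
    rw [map_sum, map_zero, ← h1]
    refine Finset.sum_congr rfl fun β _ => ?_
    rw [MvPolynomial.eval_monomial, map_smul, smul_eq_mul, mul_comm,
      Finsupp.prod_fintype _ _ fun i => pow_zero _]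
  have := congrArg (MvPolynomial.coeff α) hp
  rw [MvPolynomial.coeff_sum] at this
  simp only [MvPolynomial.coeff_monomial, Finset.sum_ite_eq', hα, if_true,
    MvPolynomial.coeff_zero] at this
  exact hφ this

theorem hermiteRV_mem_chaos [IsProbabilityMeasure P] (hw : IsBrownianMotion w P)
    (hst : s < t) (hd : 0 < d) (k : ℕ) {α : Fin d →₀ ℕ}
    (hα : α ∈ Finset.univ.finsuppAntidiag k) :
    hermiteRV (hw.law_increments s t hst.le) α ∈ chaos w P k :=
  coeff_mem_of_forall_sum_mem _ _ _ (fun a => expTerm_mem_chaos hw hst hd k a) hα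

end Chaos

/-! ### The Hermite expansion of the heat kernel -/

theorem heatKernel_eq_prod {d : ℕ} {ε : ℝ} (hε : 0 < ε) (z : EuclideanSpace ℝ (Fin d)) :
    heatKernel ε z = ∏ c, gaussDensity ε (z c) := by
  have hp : 0 < 2 * Real.pi * ε := by have := Real.pi_pos; positivity
  simp only [heatKernel, gaussDensity]
  rw [Finset.prod_mul_distrib, ← Real.exp_sum, Finset.prod_const, Finset.card_univ,
    Fintype.card_fin, EuclideanSpace.norm_sq_eq, Real.sqrt_eq_rpow, inv_pow,
    ← Real.rpow_natCast, ← Real.rpow_mul hp.le, one_div, one_div_mul_eq_div]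
  congr 2
  rw [← Finset.sum_div, Finset.sum_neg_distrib]
  simp

/-- The Cauchy product, for the values of power series at `1`. -/
theorem hasSum_coeff_mul {F G : PowerSeries ℝ} {x y : ℝ}
    (hF : HasSum (fun n => PowerSeries.coeff n F) x)
    (hG : HasSum (fun n => PowerSeries.coeff n G) y) :
    HasSum (fun n => PowerSeries.coeff n (F * G)) (x * y) := by
  simp only [PowerSeries.coeff_mul]
  rw [← hF.tsum_eq, ← hG.tsum_eq, tsum_mul_tsum_eq_tsum_sum_antidiagonal_of_summable_norm
    hF.summable.norm hG.summable.norm]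
  exact (summable_norm_sum_mul_antidiagonal_of_summable_norm hF.summable.norm
    hG.summable.norm).of_norm.hasSum

theorem hasSum_coeff_prod {κ : Type*} (S : Finset κ) {F : κ → PowerSeries ℝ} {x : κ → ℝ}
    (hF : ∀ i ∈ S, HasSum (fun n => PowerSeries.coeff n (F i)) (x i)) :
    HasSum (fun n => PowerSeries.coeff n (∏ i ∈ S, F i)) (∏ i ∈ S, x i) := by
  classical
  induction S using Finset.induction_on with
  | empty =>
    simp only [Finset.prod_empty, PowerSeries.coeff_one]
    exact hasSum_ite_eq 0 (1 : ℝ)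
  | insert i S hi ih =>
    rw [Finset.prod_insert hi, Finset.prod_insert hi]
    exact hasSum_coeff_mul (hF i (Finset.mem_insert_self i S))
      (ih fun j hj => hF j (Finset.mem_insert_of_mem hj))

/-- The coefficient of `∏ c, g_{α c}(X_c)` in the expansion of the heat kernel of variance `σ - v`
at `X - u`, where `X` has variance `v`. It does not depend on `v`. -/
noncomputable def heatCoeff {d : ℕ} (σ : ℝ) (u : Fin d → ℝ) (α : Fin d →₀ ℕ) : ℝ :=
  ∏ c, gaussDensity σ (u c) * ((α c).factorial / σ ^ α c * divHermite σ (α c) (u c))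

section Expansion

variable {d : ℕ} {Ω : Type*} [MeasurableSpace Ω] {P : Measure Ω} {v : ℝ≥0} {ξ : Ω → Fin d → ℝ}
  (hξ : HasLaw ξ (Measure.pi fun _ => gaussianReal 0 v) P)

/-- The component of degree `k` in the expansion of the heat kernel of variance `σ - v`, also for
`σ = v`, where it is the component of the delta function. -/
noncomputable def heatTerm (hξ : HasLaw ξ (Measure.pi fun _ => gaussianReal 0 v) P) (σ : ℝ)
    (u : Fin d → ℝ) (k : ℕ) : Lp ℝ 2 P :=
  ∑ α ∈ Finset.univ.finsuppAntidiag k, heatCoeff σ u α • hermiteRV hξ α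

theorem norm_heatTerm_sq (hv : v ≠ 0) {σ : ℝ} (hσ : 0 < σ) (u : Fin d → ℝ) (k : ℕ) :
    ‖heatTerm hξ σ u k‖ ^ 2 = ∑ α ∈ (Finset.univ : Finset (Fin d)).finsuppAntidiag k,
      ∏ c, gaussDensity σ (u c) ^ 2 * (mehlerCoeff σ (u c) (α c) * (v / σ ^ 2) ^ α c) := by
  rw [heatTerm, norm_sum_smul_hermiteRV_sq hξ hv]
  refine Finset.sum_congr rfl fun α _ => ?_
  rw [heatCoeff, ← Finset.prod_pow, ← Finset.prod_mul_distrib]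
  refine Finset.prod_congr rfl fun c _ => ?_
  have : ((α c).factorial : ℝ) ≠ 0 := by positivity
  rw [mehlerCoeff, div_pow, ← pow_mul σ 2, mul_comm 2, pow_mul]
  field_simp

/-- The generating function of the squared norms of the components, by Mehler's formula in each
coordinate. -/
theorem hasSum_norm_heatTerm_sq_mul_pow (hv : v ≠ 0) {σ q : ℝ} (hσ : 0 < σ) (hq : 0 ≤ q)
    (hqv : v / σ * q < 1) (u : Fin d → ℝ) :
    HasSum (fun k => ‖heatTerm hξ σ u k‖ ^ 2 * q ^ k)
      (∏ c, gaussDensity σ (u c) ^ 2 * (Real.exp (u c ^ 2 * (v / σ ^ 2 * q) /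
        (1 + v / σ * q)) / √(1 - (v / σ * q) ^ 2))) := by
  have e : σ * (v / σ ^ 2 * q) = v / σ * q := by field_simp
  have h := hasSum_coeff_prod Finset.univ
    (F := fun c => PowerSeries.mk fun n => gaussDensity σ (u c) ^ 2 *
      (mehlerCoeff σ (u c) n * (v / σ ^ 2 * q) ^ n)) (x := fun c => gaussDensity σ (u c) ^ 2 *
      (Real.exp (u c ^ 2 * (v / σ ^ 2 * q) / (1 + v / σ * q)) / √(1 - (v / σ * q) ^ 2)))
    fun c _ => by
      simp only [PowerSeries.coeff_mk]
      refine HasSum.mul_left _ ?_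
      rw [← e]
      exact hasSum_mehlerCoeff hσ (by positivity) (by rwa [e]) _
  refine h.congr_fun fun k => ?_
  rw [PowerSeries.coeff_prod, norm_heatTerm_sq hξ hv hσ, Finset.sum_mul]
  refine Finset.sum_congr rfl fun α hα => ?_
  have hk : ∑ c, α c = k := (Finset.mem_finsuppAntidiag.1 hα).1
  simp only [PowerSeries.coeff_mk]
  rw [← hk, ← Finset.prod_pow_eq_pow_sum, ← Finset.prod_mul_distrib]
  refine Finset.prod_congr rfl fun c _ => ?_
  rw [mul_pow]
  ring

/-- The heat kernel of variance `ε` at `ξ - u`. -/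
noncomputable def heatRV (hξ : HasLaw ξ (Measure.pi fun _ => gaussianReal 0 v) P) {ε : ℝ}
    (hε : 0 < ε) (u : Fin d → ℝ) : Lp ℝ 2 P :=
  (memLp_prod_comp hξ (φ := fun c x => gaussDensity ε (x - u c))
    (fun _ => (continuous_gaussDensity ε).comp (continuous_id.sub continuous_const))
    fun c => memLp_gaussDensity_sub hε (u c) v 2).toLp _

theorem norm_heatRV_sq (hv : v ≠ 0) {ε : ℝ} (hε : 0 < ε) (u : Fin d → ℝ) :
    ‖heatRV hξ hε u‖ ^ 2 =
      ∏ c, gaussDensity (2 * ε) 0 * gaussDensity (v + ε / 2) (u c) := by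
  have hc : ∀ c, Continuous fun x => gaussDensity ε (x - u c) := fun c =>
    (continuous_gaussDensity ε).comp (continuous_id.sub continuous_const)
  rw [← real_inner_self_eq_norm_sq, heatRV, inner_toLp]
  simp only [← integral_gaussDensity_sub_sq hv hε, sq]
  rw [← integral_prod_comp hξ (φ := fun c x => gaussDensity ε (x - u c) * gaussDensity ε (x - u c))
    fun c => (hc c).mul (hc c)]
  simp only [Finset.prod_mul_distrib]

theorem inner_heatRV_hermiteRV (hv : v ≠ 0) {ε : ℝ} (hε : 0 < ε) (u : Fin d → ℝ)
    (α : Fin d →₀ ℕ) : inner ℝ (heatRV hξ hε u) (hermiteRV hξ α) =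
      heatCoeff (v + ε) u α * ∏ c, (v : ℝ) ^ α c / ((α c).factorial : ℝ) := by
  have hσ : 0 < (v : ℝ) + ε := by positivity
  rw [heatRV, inner_toLp_hermiteRV hξ (φ := fun c x => gaussDensity ε (x - u c)) fun c =>
    (continuous_gaussDensity ε).comp (continuous_id.sub continuous_const), heatCoeff,
    ← Finset.prod_mul_distrib]
  refine Finset.prod_congr rfl fun c _ => ?_
  rw [integral_divHermite_mul_gaussDensity_sub hv hε, div_pow]
  have : ((α c).factorial : ℝ) ≠ 0 := by positivity
  field_simp

theorem inner_heatRV_heatTerm (hv : v ≠ 0) {ε : ℝ} (hε : 0 < ε) (u : Fin d → ℝ) (k : ℕ) :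
    inner ℝ (heatRV hξ hε u) (heatTerm hξ (v + ε) u k) = ‖heatTerm hξ (v + ε) u k‖ ^ 2 := by
  rw [heatTerm, norm_sum_smul_hermiteRV_sq hξ hv, inner_sum]
  refine Finset.sum_congr rfl fun α _ => ?_
  rw [inner_smul_right, inner_heatRV_hermiteRV hξ hv hε, sq, mul_assoc]

theorem inner_heatTerm (hv : v ≠ 0) (σ : ℝ) (u : Fin d → ℝ) :
    Pairwise fun k l => inner ℝ (heatTerm hξ σ u k) (heatTerm hξ σ u l) = 0 := by
  intro k l hkl
  rw [heatTerm, heatTerm, sum_inner]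
  refine Finset.sum_eq_zero fun α hα => ?_
  rw [inner_sum]
  refine Finset.sum_eq_zero fun β hβ => ?_
  have h : α ≠ β := by
    rintro rfl
    exact hkl ((Finset.mem_finsuppAntidiag.1 hα).1.symm.trans (Finset.mem_finsuppAntidiag.1 hβ).1)
  simp [inner_smul_left, inner_smul_right, inner_hermiteRV hξ hv, h]

/-- For `q = 1` the generating function of the squared norms is the squared `L²` norm of the heat
kernel, in each coordinate. -/
theorem gaussDensity_parseval {v ε : ℝ} (hv : 0 < v) (hε : 0 < ε) (x : ℝ) :
    gaussDensity (v + ε) x ^ 2 * (Real.exp (x ^ 2 * (v / (v + ε) ^ 2 * 1) /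
      (1 + v / (v + ε) * 1)) / √(1 - (v / (v + ε) * 1) ^ 2)) =
      gaussDensity (2 * ε) 0 * gaussDensity (v + ε / 2) x := by
  have hπ := Real.pi_pos
  have hσ : 0 < v + ε := by positivity
  have h1 : 1 - (v / (v + ε) * 1) ^ 2 = ε * (2 * v + ε) / (v + ε) ^ 2 := by
    field_simp
    ring
  have hc : (√(2 * Real.pi * (v + ε)))⁻¹ ^ 2 * (√(ε * (2 * v + ε) / (v + ε) ^ 2))⁻¹ =
      (√(2 * Real.pi * (2 * ε)))⁻¹ * (√(2 * Real.pi * (v + ε / 2)))⁻¹ := by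
    rw [inv_pow, Real.sq_sqrt (by positivity), ← mul_inv, ← mul_inv,
      ← Real.sqrt_mul (by positivity)]
    congr 1
    rw [Real.sqrt_div (by positivity) ((v + ε) ^ 2), Real.sqrt_sq hσ.le]
    have : 2 * Real.pi * (2 * ε) * (2 * Real.pi * (v + ε / 2)) =
        (2 * Real.pi) ^ 2 * (ε * (2 * v + ε)) := by ring
    rw [this, Real.sqrt_mul (by positivity) (ε * (2 * v + ε)),
      Real.sqrt_sq (by positivity)]
    field_simp
  have he : Real.exp (-x ^ 2 / (2 * (v + ε))) ^ 2 *
      Real.exp (x ^ 2 * (v / (v + ε) ^ 2 * 1) / (1 + v / (v + ε) * 1)) =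
      Real.exp (-x ^ 2 / (2 * (v + ε / 2))) := by
    rw [← Real.exp_nat_mul, ← Real.exp_add]
    congr 1
    have : 0 < v + ε + v := by positivity
    push_cast
    field_simp
    ring
  rw [h1]
  simp only [gaussDensity]
  rw [mul_pow, ← he, div_eq_mul_inv (Real.exp _) (√_)]
  have h0 : Real.exp (-0 ^ 2 / (2 * (2 * ε))) = 1 := by simp
  rw [h0]
  generalize Real.exp (-x ^ 2 / (2 * (v + ε))) = y at *
  generalize Real.exp (x ^ 2 * (v / (v + ε) ^ 2 * 1) / (1 + v / (v + ε) * 1)) = z at *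
  linear_combination y ^ 2 * z * hc

/-- The Itô–Wiener expansion of the heat kernel: by Mehler's formula, Parseval's identity holds. -/
theorem hasSum_heatTerm (hv : v ≠ 0) {ε : ℝ} (hε : 0 < ε) (u : Fin d → ℝ) :
    HasSum (heatTerm hξ (v + ε) u) (heatRV hξ hε u) := by
  have hv0 : 0 < (v : ℝ) := by exact_mod_cast pos_iff_ne_zero.2 hv
  have hσ : 0 < (v : ℝ) + ε := by positivity
  refine hasSum_of_hasSum_norm_sq (inner_heatTerm hξ hv _ u)
    (fun k => inner_heatRV_heatTerm hξ hv hε u k) ?_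
  have h := hasSum_norm_heatTerm_sq_mul_pow hξ hv hσ zero_le_one
    (by rw [mul_one, div_lt_one hσ]; linarith) u
  rw [norm_heatRV_sq hξ hv hε]
  simp only [gaussDensity_parseval hv0 hε] at h
  simpa only [one_pow, mul_one] using h

/-- The exponential factors of the generating function are at most `exp (u_c² / (2σ))`, which turns
`p_σ(u)²` into `p_σ(u / √2)²`. -/
theorem sum_norm_heatTerm_sq_mul_pow_le (hv : v ≠ 0) {σ q : ℝ} (hσ : v ≤ σ) (hq : 0 ≤ q)
    (hq1 : q < 1) (u : EuclideanSpace ℝ (Fin d)) (S : Finset ℕ) :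
    ∑ k ∈ S, ‖heatTerm hξ σ u k‖ ^ 2 * q ^ k ≤
      heatKernel σ ((√2)⁻¹ • u) ^ 2 * ((√(1 - q)) ^ d)⁻¹ := by
  have hv0 : 0 < (v : ℝ) := by exact_mod_cast pos_iff_ne_zero.2 hv
  have hσ0 : 0 < σ := hv0.trans_le hσ
  have hρ1 : v / σ ≤ 1 := (div_le_one hσ0).2 hσ
  have hρ0 : 0 < v / σ := by positivity
  have hρq : v / σ * q ≤ q := mul_le_of_le_one_left hq hρ1
  refine (sum_le_hasSum S (fun k _ => by positivity) (hasSum_norm_heatTerm_sq_mul_pow hξ hv hσ0 hq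
    (hρq.trans_lt hq1) u)).trans ?_
  have e : heatKernel σ ((√2)⁻¹ • u) ^ 2 * ((√(1 - q)) ^ d)⁻¹ =
      ∏ c : Fin d, gaussDensity σ ((√2)⁻¹ * u c) ^ 2 * (√(1 - q))⁻¹ := by
    rw [heatKernel_eq_prod hσ0, Finset.prod_mul_distrib, Finset.prod_pow, Finset.prod_const,
      inv_pow, Finset.card_univ, Fintype.card_fin]
    simp
  rw [e]
  refine Finset.prod_le_prod (fun c _ => by positivity) fun c _ => ?_
  have h1 : u c ^ 2 * (v / σ ^ 2 * q) / (1 + v / σ * q) ≤ u c ^ 2 / (2 * σ) := by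
    have e2 : v / σ ^ 2 * q = v / σ * q / σ := by field_simp
    rw [e2]
    set x := v / σ * q with hx
    have hx0 : 0 ≤ x := by positivity
    have hx1 : x ≤ 1 := hρq.trans hq1.le
    rw [div_le_div_iff₀ (by positivity) (by positivity)]
    have : u c ^ 2 * (x / σ) * (2 * σ) = u c ^ 2 * (2 * x) := by field_simp
    rw [this]
    exact mul_le_mul_of_nonneg_left (by linarith) (sq_nonneg _)
  have h2 : √(1 - q) ≤ √(1 - (v / σ * q) ^ 2) := by
    refine Real.sqrt_le_sqrt ?_
    have : 0 ≤ v / σ * q := by positivity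
    nlinarith
  have h3 : 0 < √(1 - q) := Real.sqrt_pos.2 (by linarith)
  have h4 : gaussDensity σ ((√2)⁻¹ * u c) ^ 2 =
      gaussDensity σ (u c) ^ 2 * Real.exp (u c ^ 2 / (2 * σ)) := by
    simp only [gaussDensity]
    rw [mul_pow, mul_pow _ (Real.exp _), mul_assoc (_ ^ 2), ← Real.exp_nat_mul, ← Real.exp_nat_mul,
      ← Real.exp_add, mul_pow, inv_pow √2, Real.sq_sqrt (by norm_num)]
    congr 2
    push_cast
    field_simp
    ring
  rw [h4, mul_assoc, ← div_eq_mul_inv]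
  refine mul_le_mul_of_nonneg_left ?_ (sq_nonneg _)
  exact div_le_div₀ (Real.exp_pos _).le (Real.exp_le_exp.2 h1) h3 h2

end Expansion

/-! ### Weighted sums controlled by a generating function -/

/-- The constant in the comparison of weighted sums with weights `(k + 1) ^ γ` with a generating
function of growth `(1 - q) ^ (-d / 2)`. -/
noncomputable def chaosConst (γ : ℝ) (d : ℕ) : ℝ :=
  (Real.Gamma (-γ))⁻¹ * ∫ x in Set.Ioi (0 : ℝ),
    x ^ (-γ - 1) * Real.exp (-x) * ((√(1 - Real.exp (-x))) ^ d)⁻¹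

theorem neg_of_lt_neg_half {γ : ℝ} {d : ℕ} (h : γ < -(d : ℝ) / 2) : γ < 0 := by
  have : (0 : ℝ) ≤ d := Nat.cast_nonneg d
  linarith

theorem chaosConst_nonneg {γ : ℝ} {d : ℕ} (h : γ < -(d : ℝ) / 2) : 0 ≤ chaosConst γ d := by
  have h0 := neg_of_lt_neg_half h
  refine mul_nonneg (inv_nonneg.2 (Real.Gamma_pos_of_pos (by linarith)).le)
    (setIntegral_nonneg measurableSet_Ioi fun x hx => ?_)
  have hx' : (0 : ℝ) < x := hx
  positivity

/-- At `0` the integrand is of order `x ^ (-γ - 1 - d / 2)`, which is where `γ < -d / 2` enters. -/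
theorem integrableOn_chaosConst {γ : ℝ} {d : ℕ} (h : γ < -(d : ℝ) / 2) :
    IntegrableOn (fun x => x ^ (-γ - 1) * Real.exp (-x) * ((√(1 - Real.exp (-x))) ^ d)⁻¹)
      (Set.Ioi (0 : ℝ)) := by
  let K : ℝ := 2 ^ d * d.factorial * Real.exp (1 / 2)
  have hint : IntegrableOn (fun x : ℝ => K * (x ^ (-γ - 1 - d / 2) *
      Real.exp (-(1 / 2) * x ^ (1 : ℝ)))) (Set.Ioi (0 : ℝ)) :=
    (integrableOn_rpow_mul_exp_neg_mul_rpow (by linarith) one_pos (by norm_num)).const_mul K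
  refine Integrable.mono' hint ?_ ?_
  · refine (ContinuousOn.aestronglyMeasurable ?_ measurableSet_Ioi)
    intro x hx
    have hx' : (0 : ℝ) < x := hx
    have h1 : 0 < 1 - Real.exp (-x) := by
      rw [sub_pos, Real.exp_lt_one_iff]
      linarith
    refine ContinuousAt.continuousWithinAt ?_
    refine ((Real.continuousAt_rpow_const x _ (Or.inl hx'.ne')).mul (by fun_prop)).mul
      (ContinuousAt.inv₀ (by fun_prop) ?_)
    exact (pow_pos (Real.sqrt_pos.2 h1) d).ne'
  · refine (ae_restrict_iff' measurableSet_Ioi).2 (Eventually.of_forall fun x hx => ?_)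
    have hx' : (0 : ℝ) < x := hx
    have h1 : x / (1 + x) ≤ 1 - Real.exp (-x) := by
      have h2 := Real.add_one_le_exp x
      have h3 : Real.exp (-x) ≤ (1 + x)⁻¹ := by
        rw [Real.exp_neg]
        exact inv_anti₀ (by positivity) (by linarith)
      have h4 : x / (1 + x) = 1 - (1 + x)⁻¹ := by field_simp; ring
      linarith
    have h2 : ((√(1 - Real.exp (-x))) ^ d)⁻¹ ≤ x ^ (-(d : ℝ) / 2) * (1 + x) ^ d := by
      have h3 : √(x / (1 + x)) ^ d ≤ √(1 - Real.exp (-x)) ^ d :=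
        pow_le_pow_left₀ (Real.sqrt_nonneg _) (Real.sqrt_le_sqrt h1) d
      have h4 : 0 < √(x / (1 + x)) ^ d := by positivity
      refine (inv_anti₀ h4 h3).trans ?_
      rw [Real.sqrt_div hx'.le, div_pow, inv_div, div_eq_mul_inv, mul_comm]
      have h5 : (√x ^ d)⁻¹ = x ^ (-(d : ℝ) / 2) := by
        rw [Real.sqrt_eq_rpow, ← Real.rpow_natCast, ← Real.rpow_mul hx'.le,
          ← Real.rpow_neg hx'.le]
        congr 1
        ring
      rw [h5]
      refine mul_le_mul_of_nonneg_left (pow_le_pow_left₀ (Real.sqrt_nonneg _) ?_ d) (by positivity)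
      rw [Real.sqrt_le_left (by positivity)]
      nlinarith
    have h6 : (1 + x) ^ d ≤ K * Real.exp (1 / 2 * x) := by
      have h7 := Real.pow_div_factorial_le_exp ((1 + x) / 2) (by positivity) d
      rw [div_le_iff₀ (by positivity), div_pow, div_le_iff₀ (by positivity)] at h7
      refine h7.trans_eq ?_
      have : (1 + x) / 2 = 1 / 2 + 1 / 2 * x := by ring
      rw [this, Real.exp_add]
      ring
    rw [Real.norm_of_nonneg (by positivity), Real.rpow_one]
    calc x ^ (-γ - 1) * Real.exp (-x) * ((√(1 - Real.exp (-x))) ^ d)⁻¹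
        ≤ x ^ (-γ - 1) * Real.exp (-x) * (x ^ (-(d : ℝ) / 2) * (K * Real.exp (1 / 2 * x))) := by
          refine mul_le_mul_of_nonneg_left (h2.trans ?_) (by positivity)
          exact mul_le_mul_of_nonneg_left h6 (by positivity)
      _ = K * ((x ^ (-γ - 1) * x ^ (-(d : ℝ) / 2)) * (Real.exp (-x) * Real.exp (1 / 2 * x))) := by
          ring
      _ = _ := by
          rw [← Real.rpow_add hx', ← Real.exp_add]
          congr 3 <;> ring_nf

/-- The weights are Gamma integrals: `(k + 1) ^ γ = Γ(-γ)⁻¹ ∫ x ^ (-γ - 1) e ^ (-(k + 1) x) dx`. -/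
theorem sum_rpow_mul_le {γ : ℝ} {d : ℕ} (h : γ < -(d : ℝ) / 2) {a : ℕ → ℝ} {B : ℝ}
    (S : Finset ℕ)
    (hB : ∀ q : ℝ, 0 ≤ q → q < 1 → ∑ k ∈ S, a k * q ^ k ≤ B * ((√(1 - q)) ^ d)⁻¹) :
    ∑ k ∈ S, ((k : ℝ) + 1) ^ γ * a k ≤ chaosConst γ d * B := by
  have h0 := neg_of_lt_neg_half h
  have hΓ : 0 < Real.Gamma (-γ) := Real.Gamma_pos_of_pos (by linarith)
  have hk : ∀ k : ℕ, IntegrableOn (fun x : ℝ => x ^ (-γ - 1) * Real.exp (-(((k : ℝ) + 1) * x)))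
      (Set.Ioi 0) := fun k => by
    have := integrableOn_rpow_mul_exp_neg_mul_rpow (p := 1) (s := -γ - 1) (b := (k : ℝ) + 1)
      (by linarith) one_pos (by positivity)
    refine this.congr_fun (fun x _ => ?_) measurableSet_Ioi
    simp only [Real.rpow_one, neg_mul]
  have hw : ∀ k : ℕ, ((k : ℝ) + 1) ^ γ = (Real.Gamma (-γ))⁻¹ *
      ∫ x in Set.Ioi (0 : ℝ), x ^ (-γ - 1) * Real.exp (-(((k : ℝ) + 1) * x)) := fun k => by
    rw [Real.integral_rpow_mul_exp_neg_mul_Ioi (by linarith) (by positivity), one_div,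
      Real.inv_rpow (by positivity), Real.rpow_neg (by positivity), inv_inv]
    field_simp
  have e : ∑ k ∈ S, ((k : ℝ) + 1) ^ γ * a k = (Real.Gamma (-γ))⁻¹ *
      ∫ x in Set.Ioi (0 : ℝ), ∑ k ∈ S, a k * (x ^ (-γ - 1) * Real.exp (-(((k : ℝ) + 1) * x))) := by
    rw [integral_finsetSum _ fun k _ => (hk k).const_mul (a k), Finset.mul_sum]
    refine Finset.sum_congr rfl fun k _ => ?_
    rw [hw, integral_const_mul]
    ring
  rw [e, chaosConst, mul_assoc]
  refine mul_le_mul_of_nonneg_left ?_ (inv_nonneg.2 hΓ.le)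
  rw [← integral_mul_const]
  refine setIntegral_mono_on (integrable_finsetSum _ fun k _ => (hk k).const_mul (a k))
    ((integrableOn_chaosConst h).mul_const B) measurableSet_Ioi fun x hx => ?_
  have hx' : (0 : ℝ) < x := hx
  have hb := hB (Real.exp (-x)) (Real.exp_pos _).le (Real.exp_lt_one_iff.2 (by linarith))
  have e2 : ∑ k ∈ S, a k * (x ^ (-γ - 1) * Real.exp (-(((k : ℝ) + 1) * x))) =
      x ^ (-γ - 1) * Real.exp (-x) * ∑ k ∈ S, a k * Real.exp (-x) ^ k := by
    rw [Finset.mul_sum]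
    refine Finset.sum_congr rfl fun k _ => ?_
    have : Real.exp (-(((k : ℝ) + 1) * x)) = Real.exp (-x) * Real.exp (-x) ^ k := by
      rw [← Real.exp_nat_mul, ← Real.exp_add]
      congr 1
      ring
    rw [this]
    ring
  rw [e2]
  refine (mul_le_mul_of_nonneg_left hb (by positivity)).trans_eq ?_
  ring

/-- A bound with a larger exponent makes the tails of the weighted sums uniformly small, so that
termwise convergence implies convergence. -/
theorem eventually_sum_rpow_mul_le {α : Type*} {l : Filter α} {γ γ' : ℝ} (hγ : γ < γ')
    {a : α → ℕ → ℝ} (ha : ∀ x k, 0 ≤ a x k) (hlim : ∀ k, Tendsto (fun x => a x k) l (𝓝 0))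
    {B : ℝ} (hB : ∀ᶠ x in l, ∀ S : Finset ℕ, ∑ k ∈ S, ((k : ℝ) + 1) ^ γ' * a x k ≤ B)
    {ρ : ℝ} (hρ : 0 < ρ) :
    ∀ᶠ x in l, ∀ S : Finset ℕ, ∑ k ∈ S, ((k : ℝ) + 1) ^ γ * a x k ≤ ρ := by
  have ht : Tendsto (fun K : ℕ => ((K : ℝ) + 1) ^ (γ - γ') * B) atTop (𝓝 0) := by
    have h1 : Tendsto (fun K : ℕ => (K : ℝ) + 1) atTop atTop :=
      tendsto_atTop_add_const_right _ _ tendsto_natCast_atTop_atTop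
    have h2 := ((tendsto_rpow_neg_atTop (sub_pos.2 hγ)).comp h1).mul_const B
    rw [zero_mul] at h2
    refine h2.congr fun K => ?_
    simp
  obtain ⟨K, hK⟩ := (ht.eventually (gt_mem_nhds (half_pos hρ))).exists
  have hfin : Tendsto (fun x => ∑ k ∈ Finset.range K, ((k : ℝ) + 1) ^ γ * a x k) l (𝓝 0) := by
    have := tendsto_finsetSum (Finset.range K) fun k _ => (hlim k).const_mul (((k : ℝ) + 1) ^ γ)
    simpa using this
  filter_upwards [hB, hfin.eventually (gt_mem_nhds (half_pos hρ))] with x hx1 hx2 S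
  have hn : ∀ k : ℕ, 0 ≤ ((k : ℝ) + 1) ^ γ * a x k := fun k =>
    mul_nonneg (by positivity) (ha x k)
  rw [← Finset.sum_filter_add_sum_filter_not S (fun k => k < K)]
  have h1 : ∑ k ∈ S with k < K, ((k : ℝ) + 1) ^ γ * a x k ≤
      ∑ k ∈ Finset.range K, ((k : ℝ) + 1) ^ γ * a x k :=
    Finset.sum_le_sum_of_subset_of_nonneg (fun k hk => by simpa using (Finset.mem_filter.1 hk).2)
      fun k _ _ => hn k
  have h2 : ∑ k ∈ S with ¬ k < K, ((k : ℝ) + 1) ^ γ * a x k ≤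
      ((K : ℝ) + 1) ^ (γ - γ') * B := by
    refine le_trans ?_ (mul_le_mul_of_nonneg_left (hx1 (S.filter fun k => ¬ k < K))
      (by positivity))
    rw [Finset.mul_sum]
    refine Finset.sum_le_sum fun k hk => ?_
    have hkK : (K : ℝ) + 1 ≤ (k : ℝ) + 1 := by
      have : K ≤ k := not_lt.1 (Finset.mem_filter.1 hk).2
      gcongr
    have h3 : ((k : ℝ) + 1) ^ γ = ((k : ℝ) + 1) ^ (γ - γ') * ((k : ℝ) + 1) ^ γ' := by
      rw [← Real.rpow_add (by positivity), sub_add_cancel]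
    rw [h3, mul_assoc]
    refine mul_le_mul_of_nonneg_right ?_ (mul_nonneg (by positivity) (ha x k))
    exact Real.rpow_le_rpow_of_nonpos (by positivity) hkK (by linarith)
  linarith

/-! ### Orthogonal series in the Sobolev spaces -/

section OrthogonalSeries

variable {E : Type*} [NormedAddCommGroup E] [InnerProductSpace ℝ E] {ι : Type*}

theorem summable_of_orthogonal [CompleteSpace E] {X : ι → E}
    (hX : Pairwise fun i j => inner ℝ (X i) (X j) = 0) (h : Summable fun i => ‖X i‖ ^ 2) :
    Summable X := by
  rw [summable_iff_vanishing_norm] at h ⊢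
  intro ε hε
  obtain ⟨s, hs⟩ := h (ε ^ 2) (by positivity)
  refine ⟨s, fun t ht => ?_⟩
  have h1 := hs t ht
  rw [← norm_sum_sq_of_orthogonal hX, Real.norm_of_nonneg (sq_nonneg _)] at h1
  exact lt_of_pow_lt_pow_left₀ 2 hε.le h1

theorem norm_tsum_sq_le_of_orthogonal {X : ι → E} {x : E}
    (hX : Pairwise fun i j => inner ℝ (X i) (X j) = 0) (hx : HasSum X x) {B : ℝ}
    (hB : ∀ S : Finset ι, ∑ i ∈ S, ‖X i‖ ^ 2 ≤ B) : ‖x‖ ^ 2 ≤ B := by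
  refine le_of_tendsto ((hx.norm).pow 2) (Eventually.of_forall fun S => ?_)
  rw [norm_sum_sq_of_orthogonal hX]
  exact hB S

end OrthogonalSeries

section Sobolev

variable {d : ℕ} {Ω : Type*} [MeasurableSpace Ω] {P : Measure Ω}
  {w : unitInterval → Ω → EuclideanSpace ℝ (Fin d)} {γ : ℝ}

namespace FiniteChaos

theorem component_single_same (k : ℕ) (X : chaos w P k) :
    (single k X : FiniteChaos w P γ).component k = X :=
  DFinsupp.single_eq_same

theorem component_single_of_ne {k l : ℕ} (h : l ≠ k) (X : chaos w P k) :
    (single k X : FiniteChaos w P γ).component l = 0 :=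
  DFinsupp.single_eq_of_ne h

theorem inner_single_left (k : ℕ) (X : chaos w P k) (F : FiniteChaos w P γ) :
    inner ℝ (single k X) F = ((k : ℝ) + 1) ^ γ * inner ℝ X (F.component k) := by
  change innerProd (single k X) F = _
  rw [innerProd_eq_sum (S := {k}), Finset.sum_singleton, component_single_same]
  intro l hl
  rw [mem_supp] at hl
  by_contra h
  exact hl (component_single_of_ne (by simpa using h) X)

theorem single_sub (k : ℕ) (X Y : chaos w P k) :
    (single k (X - Y) : FiniteChaos w P γ) = single k X - single k Y :=
  DFinsupp.single_sub ..

end FiniteChaos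

/-- An element of the `k`-th chaos, as an element of the Sobolev space. -/
noncomputable def sobolevSingle (γ : ℝ) (k : ℕ) (X : chaos w P k) : SobolevD w P γ :=
  ((FiniteChaos.single k X : FiniteChaos w P γ) : SobolevD w P γ)

theorem norm_sobolevSingle_sq (k : ℕ) (X : chaos w P k) :
    ‖sobolevSingle γ k X‖ ^ 2 = ((k : ℝ) + 1) ^ γ * ‖(X : Lp ℝ 2 P)‖ ^ 2 := by
  rw [sobolevSingle, UniformSpace.Completion.norm_coe, ← real_inner_self_eq_norm_sq,
    FiniteChaos.inner_single_left, FiniteChaos.component_single_same, real_inner_self_eq_norm_sq]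
  rfl

theorem inner_sobolevSingle (X : (k : ℕ) → chaos w P k) :
    Pairwise fun k l => inner ℝ (sobolevSingle γ k (X k)) (sobolevSingle γ l (X l)) = 0 := by
  intro k l h
  rw [sobolevSingle, sobolevSingle, UniformSpace.Completion.inner_coe,
    FiniteChaos.inner_single_left, FiniteChaos.component_single_of_ne h]
  simp

theorem sobolevSingle_sub (k : ℕ) (X Y : chaos w P k) :
    sobolevSingle γ k (X - Y) = sobolevSingle γ k X - sobolevSingle γ k Y := by
  rw [sobolevSingle, FiniteChaos.single_sub, UniformSpace.Completion.coe_sub]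
  rfl

/-- The inclusion of Sobolev spaces is compatible with orthogonal series. -/
theorem hasSum_sobolevInclusion {γ' : ℝ} (h : γ ≤ γ') {X : (k : ℕ) → chaos w P k}
    {x : SobolevD w P γ'} (hx : HasSum (fun k => sobolevSingle γ' k (X k)) x) :
    HasSum (fun k => sobolevSingle γ k (X k)) (sobolevInclusion w P h x) := by
  have hc : Continuous (sobolevInclusion w P h) := UniformSpace.Completion.continuous_map
  have h1 : Tendsto (fun S : Finset ℕ => sobolevInclusion w P h
      (∑ k ∈ S, sobolevSingle γ' k (X k))) atTop (𝓝 (sobolevInclusion w P h x)) :=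
    (hc.tendsto x).comp hx
  refine h1.congr fun S => ?_
  have e : ∀ β : ℝ, ∑ k ∈ S, sobolevSingle β k (X k) =
      ((∑ k ∈ S, FiniteChaos.single k (X k) : FiniteChaos w P β) : SobolevD w P β) := fun β =>
    (map_sum (UniformSpace.Completion.toComplₗᵢ (𝕜 := ℝ) (E := FiniteChaos w P β)) _ S).symm
  rw [e γ, e γ', sobolevInclusion,
    UniformSpace.Completion.map_coe (FiniteChaos.weaken w P h).uniformContinuous, map_sum]
  rfl

end Sobolev

/-! ### The delta function of an increment -/

theorem continuousAt_gaussDensity {σ : ℝ} (hσ : 0 < σ) (x : ℝ) :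
    ContinuousAt (fun σ => gaussDensity σ x) σ := by
  have := Real.pi_pos
  have h1 : √(2 * Real.pi * σ) ≠ 0 := (Real.sqrt_pos.2 (by positivity)).ne'
  have h2 : 2 * σ ≠ 0 := by positivity
  unfold gaussDensity
  fun_prop (disch := assumption)

theorem continuousAt_heatTerm {d : ℕ} {Ω : Type*} [MeasurableSpace Ω] {P : Measure Ω} {v : ℝ≥0}
    {ξ : Ω → Fin d → ℝ} (hξ : HasLaw ξ (Measure.pi fun _ => gaussianReal 0 v) P) {σ : ℝ}
    (hσ : 0 < σ) (u : Fin d → ℝ) (k : ℕ) : ContinuousAt (fun σ => heatTerm hξ σ u k) σ := by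
  refine tendsto_finsetSum _ fun α _ => Tendsto.smul_const (tendsto_finsetProd _ fun c _ => ?_) _
  refine (continuousAt_gaussDensity hσ (u c)).mul (ContinuousAt.mul ?_ ?_)
  · exact continuousAt_const.div (continuousAt_id.pow _) (pow_ne_zero _ hσ.ne')
  · exact ((continuous_divHermite (α c)).comp (Continuous.prodMk_left (u c))).continuousAt

theorem heatKernel_pos {d : ℕ} {ε : ℝ} (hε : 0 < ε) (z : EuclideanSpace ℝ (Fin d)) :
    0 < heatKernel ε z := by
  have := Real.pi_pos
  unfold heatKernel
  positivity

theorem heatKernel_le {d : ℕ} {v σ : ℝ} (hv : 0 < v) (hσ : v ≤ σ)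
    (z : EuclideanSpace ℝ (Fin d)) :
    heatKernel σ z ≤ 1 / (2 * Real.pi * v) ^ ((d : ℝ) / 2) := by
  have := Real.pi_pos
  have hσ0 := hv.trans_le hσ
  have h1 : Real.exp (-‖z‖ ^ 2 / (2 * σ)) ≤ 1 := by
    rw [Real.exp_le_one_iff, neg_div]
    exact neg_nonpos.2 (by positivity)
  refine (mul_le_of_le_one_right (by positivity) h1).trans ?_
  gcongr

section Delta

variable {d : ℕ} {Ω : Type*} [MeasurableSpace Ω] {P : Measure Ω} [IsProbabilityMeasure P]
  {w : unitInterval → Ω → EuclideanSpace ℝ (Fin d)} {s t : unitInterval}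

/-- The component of degree `k` of the heat kernel of variance `σ - (t - s)` at
`w t - w s - u`, as an element of the chaos. -/
noncomputable def chaosTerm (hw : IsBrownianMotion w P) (hst : s < t) (hd : 0 < d)
    (u : EuclideanSpace ℝ (Fin d)) (σ : ℝ) (k : ℕ) : chaos w P k :=
  ⟨heatTerm (hw.law_increments s t hst.le) σ u k, Submodule.sum_mem _ fun _ hα =>
    Submodule.smul_mem _ _ (hermiteRV_mem_chaos hw hst hd k hα)⟩

variable (hw : IsBrownianMotion w P) (hst : s < t) (hd : 0 < d) (u : EuclideanSpace ℝ (Fin d))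

/-- The series of the components of degree `k` in `𝔻^{2,γ}`: the heat kernel of variance
`σ - (t - s)` at `w t - w s - u`, and for `σ = t - s` the delta function. -/
noncomputable def deltaSeries (γ σ : ℝ) : SobolevD w P γ :=
  ∑' k, sobolevSingle γ k (chaosTerm hw hst hd u σ k)

/-- The bound is uniform in `σ ≥ t - s`, including `σ = t - s`. -/
theorem sum_norm_chaosTerm_le {γ : ℝ} (hγ : γ < -(d : ℝ) / 2) {σ : ℝ} (hσ : (t : ℝ) - s ≤ σ)
    (S : Finset ℕ) :
    ∑ k ∈ S, ((k : ℝ) + 1) ^ γ * ‖(chaosTerm hw hst hd u σ k : Lp ℝ 2 P)‖ ^ 2 ≤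
      chaosConst γ d * heatKernel σ ((√2)⁻¹ • u) ^ 2 := by
  have h0 : (0 : ℝ) < (t : ℝ) - s := sub_pos.2 hst
  refine sum_rpow_mul_le hγ S fun q hq hq1 => ?_
  exact sum_norm_heatTerm_sq_mul_pow_le (hw.law_increments s t hst.le)
    (Real.toNNReal_pos.2 h0).ne' (by rwa [Real.coe_toNNReal _ h0.le]) hq hq1 u S

theorem hasSum_deltaSeries {γ : ℝ} (hγ : γ < -(d : ℝ) / 2) {σ : ℝ} (hσ : (t : ℝ) - s ≤ σ) :
    HasSum (fun k => sobolevSingle γ k (chaosTerm hw hst hd u σ k))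
      (deltaSeries hw hst hd u γ σ) := by
  refine (summable_of_orthogonal (inner_sobolevSingle _) ?_).hasSum
  simp only [norm_sobolevSingle_sq]
  exact summable_of_sum_le (fun k => by positivity) (sum_norm_chaosTerm_le hw hst hd u hγ hσ)

theorem norm_deltaSeries_sq_le {γ : ℝ} (hγ : γ < -(d : ℝ) / 2) {σ : ℝ} (hσ : (t : ℝ) - s ≤ σ) :
    ‖deltaSeries hw hst hd u γ σ‖ ^ 2 ≤ chaosConst γ d * heatKernel σ ((√2)⁻¹ • u) ^ 2 := by
  refine norm_tsum_sq_le_of_orthogonal (inner_sobolevSingle _)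
    (hasSum_deltaSeries hw hst hd u hγ hσ) fun S => ?_
  simp only [norm_sobolevSingle_sq]
  exact sum_norm_chaosTerm_le hw hst hd u hγ hσ S

/-- For `ε > 0` the series is the Itô–Wiener expansion of the heat kernel. -/
theorem isRandomVariable_deltaSeries {γ : ℝ} (hγ : γ < -(d : ℝ) / 2) {ε : ℝ} (hε : 0 < ε) :
    IsRandomVariable (deltaSeries hw hst hd u γ ((t : ℝ) - s + ε))
      fun ω => heatKernel ε (w t ω - w s ω - u) := by
  have h0 : (0 : ℝ) < (t : ℝ) - s := sub_pos.2 hst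
  have hξ := hw.law_increments s t hst.le
  refine ⟨heatRV hξ hε u, ?_, chaosTerm hw hst hd u _, ?_,
    hasSum_deltaSeries hw hst hd u hγ (by linarith)⟩
  · refine (MemLp.coeFn_toLp _).trans (Eventually.of_forall fun ω => ?_)
    simp only
    rw [heatKernel_eq_prod hε]
    rfl
  · have := hasSum_heatTerm hξ (Real.toNNReal_pos.2 h0).ne' hε u
    rwa [Real.coe_toNNReal _ h0.le] at this

/-- Convergence in `𝔻^{2,γ}`: every component converges, and the norms in `𝔻^{2,γ'}` stay bounded
for `γ < γ' < -d / 2`. -/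
theorem tendsto_deltaSeries {γ : ℝ} (hγ : γ < -(d : ℝ) / 2) :
    Tendsto (fun ε => deltaSeries hw hst hd u γ ((t : ℝ) - s + ε)) (𝓝[>] 0)
      (𝓝 (deltaSeries hw hst hd u γ ((t : ℝ) - s))) := by
  have h0 : (0 : ℝ) < (t : ℝ) - s := sub_pos.2 hst
  set τ : ℝ := (t : ℝ) - s with hτ
  obtain ⟨γ', hγγ', hγ'⟩ := exists_between hγ
  let a : ℝ → ℕ → ℝ := fun ε k =>
    ‖((chaosTerm hw hst hd u (τ + ε) k - chaosTerm hw hst hd u τ k : chaos w P k) :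
      Lp ℝ 2 P)‖ ^ 2
  have hlim : ∀ k, Tendsto (fun ε => a ε k) (𝓝[>] 0) (𝓝 0) := fun k => by
    have h1 : Tendsto (fun ε : ℝ => τ + ε) (𝓝[>] 0) (𝓝 τ) := by
      have : Tendsto (fun ε : ℝ => τ + ε) (𝓝 0) (𝓝 (τ + 0)) :=
        (continuous_const.add continuous_id).tendsto 0
      rw [add_zero] at this
      exact this.mono_left nhdsWithin_le_nhds
    have h2 := (continuousAt_heatTerm (hw.law_increments s t hst.le) h0 u k).tendsto.comp h1
    have h3 := ((h2.sub_const (heatTerm (hw.law_increments s t hst.le) τ u k)).norm).pow 2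
    simp only [sub_self, norm_zero, ne_eq, OfNat.ofNat_ne_zero, not_false_eq_true, zero_pow] at h3
    exact h3
  let M : ℝ := chaosConst γ' d * (1 / (2 * Real.pi * τ) ^ ((d : ℝ) / 2)) ^ 2
  have hM : ∀ σ, τ ≤ σ → ∀ S : Finset ℕ,
      ∑ k ∈ S, ((k : ℝ) + 1) ^ γ' * ‖(chaosTerm hw hst hd u σ k : Lp ℝ 2 P)‖ ^ 2 ≤ M := by
    intro σ hσ S
    refine (sum_norm_chaosTerm_le hw hst hd u hγ' hσ S).trans
      (mul_le_mul_of_nonneg_left ?_ (chaosConst_nonneg hγ'))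
    exact pow_le_pow_left₀ (heatKernel_pos (h0.trans_le hσ) _).le (heatKernel_le h0 hσ _) 2
  have hB : ∀ᶠ ε in 𝓝[>] (0 : ℝ), ∀ S : Finset ℕ,
      ∑ k ∈ S, ((k : ℝ) + 1) ^ γ' * a ε k ≤ 2 * M + 2 * M := by
    filter_upwards [self_mem_nhdsWithin] with ε hε S
    have hε' : (0 : ℝ) < ε := hε
    refine le_trans ?_ (add_le_add (mul_le_mul_of_nonneg_left (hM (τ + ε) (by linarith) S)
      zero_le_two) (mul_le_mul_of_nonneg_left (hM τ le_rfl S) zero_le_two))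
    rw [Finset.mul_sum, Finset.mul_sum, ← Finset.sum_add_distrib]
    refine Finset.sum_le_sum fun k _ => ?_
    -- `‖x - y‖² ≤ 2 ‖x‖² + 2 ‖y‖²`
    have h1 : a ε k ≤ 2 * ‖(chaosTerm hw hst hd u (τ + ε) k : Lp ℝ 2 P)‖ ^ 2 +
        2 * ‖(chaosTerm hw hst hd u τ k : Lp ℝ 2 P)‖ ^ 2 := by
      have h2 := norm_sub_le (chaosTerm hw hst hd u (τ + ε) k : Lp ℝ 2 P)
        (chaosTerm hw hst hd u τ k)
      have h3 := pow_le_pow_left₀ (norm_nonneg _) h2 2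
      have h4 := add_sq_le (a := ‖(chaosTerm hw hst hd u (τ + ε) k : Lp ℝ 2 P)‖)
        (b := ‖(chaosTerm hw hst hd u τ k : Lp ℝ 2 P)‖)
      refine (h3.trans h4).trans_eq (by ring)
    refine (mul_le_mul_of_nonneg_left h1 (by positivity)).trans_eq ?_
    ring
  rw [Metric.tendsto_nhds]
  intro ρ hρ
  have hev := eventually_sum_rpow_mul_le hγγ' (a := a) (fun _ _ => sq_nonneg _) hlim hB
    (by positivity : 0 < (ρ / 2) ^ 2)
  filter_upwards [hev, self_mem_nhdsWithin] with ε hε hε0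
  have hε' : (0 : ℝ) < ε := hε0
  have hs := (hasSum_deltaSeries hw hst hd u hγ (by linarith : (t : ℝ) - s ≤ τ + ε)).sub
    (hasSum_deltaSeries hw hst hd u hγ hτ.symm.le)
  simp only [← sobolevSingle_sub] at hs
  have hn := norm_tsum_sq_le_of_orthogonal (inner_sobolevSingle _) hs (B := (ρ / 2) ^ 2)
    fun S => by
      simp only [norm_sobolevSingle_sq]
      exact hε S
  rw [dist_eq_norm]
  have := abs_le_of_sq_le_sq hn (by positivity)
  rw [abs_of_nonneg (norm_nonneg _)] at this
  exact this.trans_lt (half_lt_self hρ)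

end Delta

end WienerChaos

theorem mainTheorem6 :
    ∃ C c : ℝ → ℝ, (∀ γ, 0 < C γ ∧ 0 < c γ) ∧
      ∀ (d : ℕ) (Ω : Type*) [MeasurableSpace Ω] (P : Measure Ω) [IsProbabilityMeasure P]
        (w : unitInterval → Ω → EuclideanSpace ℝ (Fin d)), WienerChaos.IsBrownianMotion w P →
      ∀ (u : EuclideanSpace ℝ (Fin d)), u ≠ 0 →
      ∀ (s t : unitInterval), 0 < s → s < t → t < 1 →
      ∃ (η : (γ : ℝ) → ℝ → WienerChaos.SobolevD w P γ) (δ : (γ : ℝ) → WienerChaos.SobolevD w P γ),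
        (∀ (γ γ' : ℝ) (h : γ ≤ γ'), γ' < -(d : ℝ) / 2 →
          WienerChaos.sobolevInclusion w P h (δ γ') = δ γ) ∧
        ∀ γ : ℝ, γ < -(d : ℝ) / 2 →
          (∀ ε : ℝ, 0 < ε → WienerChaos.IsRandomVariable (η γ ε)
            (fun ω => WienerChaos.heatKernel ε (w t ω - w s ω - u))) ∧
          Tendsto (η γ) (𝓝[>] 0) (𝓝 (δ γ)) ∧
          ‖δ γ‖ ≤ C γ * WienerChaos.heatKernel ((t : ℝ) - (s : ℝ)) (c γ • u) := by
  -- only the finitely many dimensions `d < -2γ` occur; the summand `1` makes the constant positive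
  -- when there are none
  refine ⟨fun γ => 1 + ∑ d ∈ Finset.range ⌈-2 * γ⌉₊, √(WienerChaos.chaosConst γ d),
    fun _ => (√2)⁻¹, fun γ => ⟨?_, by positivity⟩, ?_⟩
  · exact add_pos_of_pos_of_nonneg one_pos (Finset.sum_nonneg fun d _ => Real.sqrt_nonneg _)
  intro d Ω _ P _ w hw u hu s t _ hst _
  have hd : 0 < d := by
    refine Nat.pos_of_ne_zero ?_
    rintro rfl
    exact hu (Subsingleton.elim _ _)
  have h0 : (0 : ℝ) < (t : ℝ) - s := sub_pos.2 hst
  refine ⟨fun γ ε => WienerChaos.deltaSeries hw hst hd u γ ((t : ℝ) - s + ε),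
    fun γ => WienerChaos.deltaSeries hw hst hd u γ ((t : ℝ) - s), fun γ γ' h hγ' => ?_,
    fun γ hγ => ⟨fun ε hε => WienerChaos.isRandomVariable_deltaSeries hw hst hd u hγ hε,
      WienerChaos.tendsto_deltaSeries hw hst hd u hγ, ?_⟩⟩
  · exact (WienerChaos.hasSum_sobolevInclusion h
      (WienerChaos.hasSum_deltaSeries hw hst hd u hγ' le_rfl)).unique
      (WienerChaos.hasSum_deltaSeries hw hst hd u (h.trans_lt hγ') le_rfl)
  · have hp := (WienerChaos.heatKernel_pos h0 ((√2)⁻¹ • u)).le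
    have h1 := WienerChaos.norm_deltaSeries_sq_le hw hst hd u hγ le_rfl
    have h2 : ‖WienerChaos.deltaSeries hw hst hd u γ ((t : ℝ) - s)‖ ≤
        √(WienerChaos.chaosConst γ d) * WienerChaos.heatKernel ((t : ℝ) - s) ((√2)⁻¹ • u) := by
      refine le_of_sq_le_sq ?_ (by positivity)
      rwa [mul_pow, Real.sq_sqrt (WienerChaos.chaosConst_nonneg hγ)]
    refine h2.trans (mul_le_mul_of_nonneg_right ?_ hp)
    have hmem : d ∈ Finset.range ⌈-2 * γ⌉₊ := by
      rw [Finset.mem_range, Nat.lt_ceil]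
      linarith
    have h3 := Finset.single_le_sum (f := fun d => √(WienerChaos.chaosConst γ d))
      (fun d _ => Real.sqrt_nonneg _) hmem
    linarith
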